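/- **The combinatorial tiling $K$.** Let $K_0$ be a combinatorial pentagon. The subdivision $\omega(C)$ of a complex $C$ of pentagons is obtained by adding a midpoint on every edge and, in every pentagon $t$ with corners $v_0,\dots,v_4$ (indices mod $5$), five new vertices $c_0,\dots,c_4$; with $m_i$ the midpoint of the edge $v_iv_{i+1}$, the pentagon $t$ is replaced by the central pentagon $c_0c_1c_2c_3c_4$ and the five outer pentagons $v_i\,m_i\,c_i\,c_{i-1}\,m_{i-1}$. Put $K_n=\omega^n(K_0)$, and let $K$ be the direct limit of the $K_n$ along the embeddings $K_n\to K_{n+1}$ that map the central pentagon to the central pentagon. The tiles of $K$ carry decorations; any decoration is allowed, that is, any assignment to the tiles of elements of a set on which the symmetry group of the regular pentagon acts (a decoration of a tile is read off after identifying the tile with the standard pentagon, and changes by the action when the identification is changed). **Tilings.** A combinatorial tiling $L$ is a complex of decorated pentagons homeomorphic to the plane. It is locally isomorphic to $K$ if for every patch $P$ of $L$ (finite set of tiles with connected union) there is a patch $Q$ of $K$ isomorphic to $P$ by a cell-preserving and decoration-preserving map. $L_{\mathrm{aff}}$ is $L$ with every tile a Euclidean regular pentagon of side length one, and with the path metric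 $d_L$ (infimum of lengths of paths); $B(x,r,L)$ is the closed $d_L$-ball of radius $r$ about $x$. **The hull.** $\Omega$ is the set of classes $[L,x]$ of pairs of a tiling $L$ locally isomorphic to $K$ and a point $x\in L_{\mathrm{aff}}$, where $(L,x)$ and $(L',x')$ are in the same class if there is a cell-preserving, decoration-preserving isomorphism $L_{\mathrm{aff}}\to L'_{\mathrm{aff}}$ that is isometric on each cell and takes $x$ to $x'$. **The distance.** For pairs $(L,x)$, $(L',x')$ let $\Lambda$ be the set of all $\varepsilon>0$ for which there are maps $$\phi:B(x,1/\varepsilon,L)\to L',\quad d_{L'}(\phi(x),x')\le\varepsilon,\qquad \phi':B(x',1/\varepsilon,L')\to L,\quad d_{L}(\phi'(x'),x)\le\varepsilon,$$ both of which are cell-preserving (on each tile whose interior meets the ball, the restriction of an isometry of that tile onto a tile), isometries for $d_L$, $d_{L'}$, and preserve the decorations of the tiles and the degrees of the vertices. Put $$d([L,x],[L',x'])=\min\bigl(\tfrac1{\sqrt2},\inf\Lambda\bigr)\qquad(\inf\emptyset=\infty).$$ **Lemma.** The function $d$ is well defined on $\Omega\times\Omega$ and is a metric: for all $X,Y,Z\in\Omega$,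 $d(X,Y)\ge0$; $d(X,Y)=0$ if and only if $X=Y$; $d(X,Y)=d(Y,X)$; and $d(X,Z)\le d(X,Y)+d(Y,Z)$. -/

import Mathlib

noncomputable section

namespace PentHull

universe u

/-! ### The regular pentagon of side length one and its symmetries -/

/-- The corner number `k` of the regular pentagon of side length one centred at the origin. -/
def pentCorner (k : Fin 5) : ℂ :=
  ((1 / (2 * Real.sin (Real.pi / 5)) : ℝ) : ℂ) *
    Complex.exp (2 * Real.pi * Complex.I * ((k : ℕ) : ℂ) / 5)

/-- The closed regular pentagon of side length one. -/
def pentagon : Set ℂ := convexHull ℝ (Set.range pentCorner)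

/-- The symmetry group of the pentagon (rotations and reflections). -/
def PentSymm : Subgroup (ℂ ≃ₗᵢ[ℝ] ℂ) where
  carrier := {g | g '' pentagon = pentagon}
  one_mem' := by simp
  mul_mem' := by
    intro a b ha hb
    simp only [Set.mem_ofPred_eq] at *
    rw [LinearIsometryEquiv.coe_mul, Set.image_comp, hb, ha]
  inv_mem' := by
    intro a ha
    simp only [Set.mem_ofPred_eq] at *
    conv_lhs => rw [← ha]
    rw [← Set.image_comp, ← LinearIsometryEquiv.coe_mul]
    simp

/-- The action of a symmetry on the points of the pentagon. -/
def symmAct (g : PentSymm) (p : pentagon) : pentagon :=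
  ⟨(g : ℂ ≃ₗᵢ[ℝ] ℂ) p, by
    have h : (g : ℂ ≃ₗᵢ[ℝ] ℂ) '' pentagon = pentagon := g.2
    exact h.subset (Set.mem_image_of_mem _ p.2)⟩

/-- The corner `k` as a point of the pentagon. -/
def cornerPt (k : Fin 5) : pentagon :=
  ⟨pentCorner k, subset_convexHull ℝ _ (Set.mem_range_self k)⟩

/-! ### Pentagonal complexes and the combinatorial pentagonal tiling -/

/-- A combinatorial pentagonal complex: vertices, tiles, and for every tile its five corners in
cyclic order. The edges are the pairs of cyclically consecutive corners of tiles. -/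
structure PentComplex where
  /-- vertices -/
  V : Type
  /-- tiles -/
  T : Type
  /-- the corners of a tile, in cyclic order -/
  corner : T → Fin 5 → V

namespace PentComplex

/-- The side of the tile `t` from corner `i` to corner `i + 1`, as an unordered pair. -/
def side (C : PentComplex) (t : C.T) (i : Fin 5) : Sym2 C.V :=
  s(C.corner t i, C.corner t (i + 1))

/-- The edges of the complex. -/
def Edge (C : PentComplex) : Type := {e : Sym2 C.V // ∃ t i, e = C.side t i}

/-- The degree of a vertex: the number of its neighbours in the 1-skeleton. -/
def degree (C : PentComplex) (v : C.V) : ℕ∞ :=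
  Set.encard {w : C.V | ∃ t i, s(v, w) = C.side t i}

/-- Maps of complexes respecting the corners of tiles. -/
structure Hom (C C' : PentComplex) where
  /-- the map on vertices -/
  vmap : C.V → C'.V
  /-- the map on tiles -/
  tmap : C.T → C'.T
  corner_tmap : ∀ t i, C'.corner (tmap t) i = vmap (C.corner t i)

theorem Hom.map_side {C C' : PentComplex} (f : Hom C C') (t : C.T) (i : Fin 5) :
    Sym2.map f.vmap (C.side t i) = C'.side (f.tmap t) i := by
  simp [side, f.corner_tmap]

/-- The map on edges. -/
def Hom.emap {C C' : PentComplex} (f : Hom C C') (e : C.Edge) : C'.Edge :=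
  ⟨Sym2.map f.vmap e.1, by
    obtain ⟨t, i, h⟩ := e.2
    exact ⟨f.tmap t, i, by rw [h, f.map_side]⟩⟩

/-- The edge of `C` underlying a side of a tile. -/
def sideEdge (C : PentComplex) (t : C.T) (i : Fin 5) : C.Edge := ⟨C.side t i, t, i, rfl⟩

/-- The subdivision of a complex: every edge gets a midpoint, every tile `t` gets five new
interior vertices `(t, i)`, the vertex `(t, i)` being joined to `(t, i + 1)`, `(t, i - 1)` and to the
midpoint of side `i`. Thus `t` is divided into a central pentagon `(t, none)` with corners `(t, i)`
and five outer pentagons `(t, some i)`, the one at the corner `i` of `t` having as corners the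
corner `i` of `t`, the midpoint of side `i`, the vertices `(t, i)` and `(t, i - 1)`, and the
midpoint of side `i - 1`. -/
def subdivide (C : PentComplex) : PentComplex where
  V := C.V ⊕ C.Edge ⊕ (C.T × Fin 5)
  T := C.T × Option (Fin 5)
  corner := fun s => match s with
    | (t, none) => fun i => Sum.inr (Sum.inr (t, i))
    | (t, some i) =>
      ![Sum.inl (C.corner t i), Sum.inr (Sum.inl (C.sideEdge t i)), Sum.inr (Sum.inr (t, i)),
        Sum.inr (Sum.inr (t, i - 1)), Sum.inr (Sum.inl (C.sideEdge t (i - 1)))]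

/-- The map of subdivisions induced by a map of complexes. -/
def Hom.subdivide {C C' : PentComplex} (f : Hom C C') : Hom C.subdivide C'.subdivide where
  vmap := Sum.map f.vmap (Sum.map f.emap (Prod.map f.tmap id))
  tmap := Prod.map f.tmap id
  corner_tmap := by
    have h : ∀ t i, C'.sideEdge (f.tmap t) i = f.emap (C.sideEdge t i) := fun t i =>
      Subtype.ext (f.map_side t i).symm
    rintro ⟨t, _ | i⟩ j
    · rfl
    · fin_cases j <;>
        simp [PentComplex.subdivide, f.corner_tmap, h]

/-- A single pentagon. -/
def single : PentComplex where
  V := Fin 5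
  T := Unit
  corner := fun _ i => i

/-- The `n`-fold subdivision of a single pentagon. -/
def level : ℕ → PentComplex
  | 0 => single
  | n + 1 => (level n).subdivide

/-- The embedding of the `n`-fold into the `(n + 1)`-fold subdivision which maps the central
pentagon to the central pentagon. -/
def levelMap : (n : ℕ) → Hom (level n) (level (n + 1))
  | 0 =>
    { vmap := fun i => Sum.inr (Sum.inr ((), i))
      tmap := fun _ => ((), none)
      corner_tmap := fun _ _ => rfl }
  | n + 1 => (levelMap n).subdivide

/-- The combinatorial pentagonal tiling `K`: the direct limit of the `n`-fold subdivisions of a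
pentagon along the embeddings `levelMap`. -/
def K : PentComplex where
  V := Quot fun a b : Σ n, (level n).V => b = ⟨a.1 + 1, (levelMap a.1).vmap a.2⟩
  T := Quot fun a b : Σ n, (level n).T => b = ⟨a.1 + 1, (levelMap a.1).tmap a.2⟩
  corner := Quot.lift (fun a i => Quot.mk _ ⟨a.1, (level a.1).corner a.2 i⟩) (by
    rintro ⟨n, t⟩ b rfl
    funext i
    rw [(levelMap n).corner_tmap t i]
    exact Quot.sound rfl)

/-! ### The piecewise affine structure and its path metric -/

/-- The point dividing the side from corner `i` to corner `i + 1` of the pentagon in the ratio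
`s : 1 - s`. -/
def sidePoint (i : Fin 5) (s : ℝ) : ℂ :=
  ((1 - s : ℝ) : ℂ) * pentCorner i + (s : ℂ) * pentCorner (i + 1)

/-- The pasting relation between points of the pentagons of the complex: two boundary points are
pasted together if they have the same barycentric coordinates with respect to the vertices of the
complex. So tiles are pasted isometrically along common edges and at common vertices. -/
def Glue (C : PentComplex) (a b : Σ _ : C.T, pentagon) : Prop :=
  ∃ (i j : Fin 5) (s s' : ℝ), s ∈ Set.Icc (0 : ℝ) 1 ∧ s' ∈ Set.Icc (0 : ℝ) 1 ∧
    (a.2 : ℂ) = sidePoint i s ∧ (b.2 : ℂ) = sidePoint j s' ∧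
    Finsupp.single (C.corner a.1 i) (1 - s) + Finsupp.single (C.corner a.1 (i + 1)) s =
      Finsupp.single (C.corner b.1 j) (1 - s') + Finsupp.single (C.corner b.1 (j + 1)) s'

/-- The space obtained by pasting regular unit pentagons together in the pattern of the complex. -/
def Aff (C : PentComplex) : Type := Quot C.Glue

/-- The CW topology, i.e. the quotient topology of the disjoint union of the pentagons. -/
instance (C : PentComplex) : TopologicalSpace C.Aff :=
  inferInstanceAs (TopologicalSpace (Quot C.Glue))

/-- The point `p` of the tile `t`. -/
def pt (C : PentComplex) (t : C.T) (p : pentagon) : C.Aff := Quot.mk _ ⟨t, p⟩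

/-- `C.Path a b l`: there is a path of length `l` from `a` to `b` composed of finitely many straight
segments, each contained in a tile. -/
inductive Path (C : PentComplex) : C.Aff → C.Aff → ℝ → Prop
  | nil (a : C.Aff) : Path C a a 0
  | cons (t : C.T) (p q : pentagon) {b : C.Aff} {l : ℝ} :
      Path C (C.pt t q) b l → Path C (C.pt t p) b (dist p q + l)

/-- The path metric: the infimum of the lengths of the paths from `a` to `b`. -/
def affDist (C : PentComplex) (a b : C.Aff) : ℝ := sInf {l | C.Path a b l}

/-- The closed metric ball. -/
def ball (C : PentComplex) (x : C.Aff) (r : ℝ) : Set C.Aff := {y | C.affDist x y ≤ r}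

/-- The union of a set of (closed) tiles. -/
def support (C : PentComplex) (P : Set C.T) : Set C.Aff := {y | ∃ t ∈ P, ∃ p, y = C.pt t p}

/-- A patch: a finite set of tiles whose union is connected. -/
def IsPatch (C : PentComplex) (P : Set C.T) : Prop := P.Finite ∧ IsConnected (C.support P)

end PentComplex

/-! ### Decorated complexes and cell-preserving maps -/

/-- A pentagonal complex with decorated tiles. Here `D` is the set of decorations of the standard
pentagon, on which the symmetries of the pentagon act, and `dec t` is the decoration of the tile `t`
when its corner `i` is placed at the corner `i` of the standard pentagon. -/
structure DecComplex (D : Type u) extends PentComplex where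
  /-- the decoration of a tile -/
  dec : T → D

/-- The tiling `K` with decorated tiles. -/
def decK {D : Type u} (κ : PentComplex.K.T → D) : DecComplex D :=
  { PentComplex.K with dec := κ }

section

variable {D : Type u} [MulAction PentSymm D]

/-- The map `F`, considered on the subset `B`, is cell-preserving and decoration-preserving and
isometric on each cell: on every tile `t` whose interior meets `B`, it is the restriction of an
isometry of `t` onto a tile `t'` that carries the decoration of `t` to that of `t'`. -/
def CellMapOn (L L' : DecComplex D) (F : L.Aff → L'.Aff) (B : Set L.Aff) : Prop :=
  ∀ t : L.T, (∃ p : pentagon, (p : ℂ) ∈ interior pentagon ∧ L.pt t p ∈ B) →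
    ∃ (t' : L'.T) (g : PentSymm), L'.dec t' = g • L.dec t ∧
      ∀ p : pentagon, L.pt t p ∈ B → F (L.pt t p) = L'.pt t' (symmAct g p)

/-- The map `F`, considered on `B`, maps vertices to vertices of the same degree. -/
def DegreeMapOn (L L' : DecComplex D) (F : L.Aff → L'.Aff) (B : Set L.Aff) : Prop :=
  ∀ (t : L.T) (i : Fin 5), L.pt t (cornerPt i) ∈ B →
    ∃ (t' : L'.T) (j : Fin 5), F (L.pt t (cornerPt i)) = L'.pt t' (cornerPt j) ∧
      L'.degree (L'.corner t' j) = L.degree (L.corner t i)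

/-- The map `F`, considered on `B`, is an isometry. -/
def IsometryOn (L L' : DecComplex D) (F : L.Aff → L'.Aff) (B : Set L.Aff) : Prop :=
  ∀ y ∈ B, ∀ z ∈ B, L'.affDist (F y) (F z) = L.affDist y z

/-- `L` is locally isomorphic to `M`: for every patch `P` of `L` there is a patch `Q` of `M` such
that `P` and `Q` are isomorphic. -/
def LocallyIsomorphic (L M : DecComplex D) : Prop :=
  ∀ P : Set L.T, L.IsPatch P → ∃ Q : Set M.T, M.IsPatch Q ∧
    ∃ F : L.Aff → M.Aff, Set.BijOn F (L.support P) (M.support Q) ∧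
      CellMapOn L M F (L.support P)

/-- A combinatorial tiling (a complex homeomorphic to the plane) that is locally isomorphic to the
decorated tiling `K`, together with a base point. -/
structure PointedTiling (κ : PentComplex.K.T → D) where
  /-- the tiling -/
  L : DecComplex D
  plane : Nonempty (L.Aff ≃ₜ ℂ)
  locIso : LocallyIsomorphic L (decK κ)
  /-- the base point -/
  x : L.Aff

/-- Isomorphism of pointed tilings: a cell-preserving and decoration-preserving bijection that is
isometric on each cell and respects the base points. -/
def PointedTiling.Iso {κ : PentComplex.K.T → D} (a b : PointedTiling κ) : Prop :=
  ∃ F : a.L.Aff ≃ b.L.Aff, CellMapOn a.L b.L F Set.univ ∧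
    CellMapOn b.L a.L F.symm Set.univ ∧ F a.x = b.x

theorem CellMapOn.comp {L L' L'' : DecComplex D} {F : L.Aff → L'.Aff} {G : L'.Aff → L''.Aff}
    (hF : CellMapOn L L' F Set.univ) (hG : CellMapOn L' L'' G Set.univ) :
    CellMapOn L L'' (G ∘ F) Set.univ := by
  intro t ht
  obtain ⟨t', g, hg, h⟩ := hF t ht
  obtain ⟨p, hp, -⟩ := ht
  have hp' : (symmAct g p : ℂ) ∈ interior pentagon := by
    have h1 : (g : ℂ ≃ₗᵢ[ℝ] ℂ) '' pentagon = pentagon := g.2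
    have h2 := (g : ℂ ≃ₗᵢ[ℝ] ℂ).toHomeomorph.image_interior pentagon
    have h3 : (g : ℂ ≃ₗᵢ[ℝ] ℂ) '' interior pentagon = interior pentagon := by
      have h4 : (g : ℂ ≃ₗᵢ[ℝ] ℂ).toHomeomorph '' pentagon = pentagon := h1
      rw [h4] at h2
      exact h2
    rw [← h3]
    exact Set.mem_image_of_mem _ hp
  obtain ⟨t'', g', hg', h'⟩ := hG t' ⟨symmAct g p, hp', trivial⟩
  refine ⟨t'', g' * g, by rw [hg', hg, mul_smul], fun q _ => ?_⟩
  simp only [Function.comp]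
  rw [h q trivial, h' _ trivial]
  rfl

/-- Isomorphism of pointed tilings is an equivalence relation. -/
instance PointedTiling.setoid (κ : PentComplex.K.T → D) : Setoid (PointedTiling κ) where
  r := PointedTiling.Iso
  iseqv := by
    refine ⟨fun a => ?_, ?_, ?_⟩
    · have h : CellMapOn a.L a.L (Equiv.refl _) Set.univ := fun t _ =>
        ⟨t, 1, by rw [one_smul], fun p _ => rfl⟩
      exact ⟨Equiv.refl _, h, h, rfl⟩
    · rintro a b ⟨F, h1, h2, h3⟩
      exact ⟨F.symm, h2, by simpa using h1, by rw [← h3, Equiv.symm_apply_apply]⟩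
    · rintro a b c ⟨F, h1, h2, h3⟩ ⟨G, k1, k2, k3⟩
      exact ⟨F.trans G, h1.comp k1, k2.comp h2, by simp [h3, k3]⟩

/-- The continuous hull `Ω`: the isomorphism classes of pointed tilings. -/
def Hull (κ : PentComplex.K.T → D) : Type (max 1 u) := Quotient (PointedTiling.setoid κ)

/-- The isomorphism class of a pointed tiling. -/
def Hull.mk {κ : PentComplex.K.T → D} (a : PointedTiling κ) : Hull κ :=
  Quotient.mk (PointedTiling.setoid κ) a

/-- `φ` is an admissible map from the `1/ε`-ball about the base point of `a` to `b`: a cell-preserving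
isometry which preserves the decorations and the degrees of the vertices and takes the base point to
a point at distance at most `ε` from the base point. -/
def Admissible {κ : PentComplex.K.T → D} (a b : PointedTiling κ) (ε : ℝ)
    (φ : a.L.Aff → b.L.Aff) : Prop :=
  CellMapOn a.L b.L φ (a.L.ball a.x (1 / ε)) ∧
  DegreeMapOn a.L b.L φ (a.L.ball a.x (1 / ε)) ∧
  IsometryOn a.L b.L φ (a.L.ball a.x (1 / ε)) ∧
  b.L.affDist (φ a.x) b.x ≤ ε

/-- The set `Λ` of all `ε > 0` such that there are admissible maps in both directions. -/
def Lam {κ : PentComplex.K.T → D} (a b : PointedTiling κ) : Set ℝ :=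
  {ε | 0 < ε ∧ (∃ φ : a.L.Aff → b.L.Aff, Admissible a b ε φ) ∧
    ∃ φ' : b.L.Aff → a.L.Aff, Admissible b a ε φ'}

/-- The minimum of `1/√2` and `inf Λ`, where the infimum of the empty set is `∞`. -/
def tilingDist {κ : PentComplex.K.T → D} (a b : PointedTiling κ) : ℝ :=
  sInf (insert (1 / Real.sqrt 2) (Lam a b))

end

end PentHull

end

namespace PentHull

open PentComplex
open scoped RealInnerProductSpace

universe u

/-! ### Geometry of the regular pentagon -/

/-! An isomorphism carries paths to paths, so it preserves `affDist`, balls and degrees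
(`CellMapOn.isometryOn`, `CellMapOn.degreeMapOn`). Admissible maps can therefore be composed with
isomorphisms on both sides, and `tilingDist` descends to the hull.

Triangle inequality: admissible maps with constants ε and δ compose to one with constant ε + δ as
soon as the first carries the ball of radius 1/(ε + δ) into the ball of radius 1/δ. This holds when
δ(ε + δ) ≤ 1 (`Admissible.comp`), and the cutoff 1/√2 disposes of all larger sums.

Definiteness: distance zero yields admissible maps on arbitrarily large balls, in both directions. A
given tile can go to only finitely many tiles, each in finitely many ways, so the maps have limits F
and G along an ultrafilter, which are cell-preserving isometries respecting the base points
(`exists_limit_of_admissible`). The composite F ∘ G fixes a base point and maps the finitely many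
tiles meeting a ball about it injectively to themselves, hence is surjective
(`CellMapOn.surjective_of_fixed`). So F is an isomorphism.

This rests on two facts about `affDist`: it separates points (`PathConnected.eq_of_affDist`), and
balls meet finitely many tiles (`finite_tiles_meeting_ball`). Both come from test functions that
respect the pasting and are Lipschitz on every tile, hence along paths: barycentric coordinates and
bumps for the first, `starFun` for the second. The homeomorphism with the plane supplies
connectedness, which gives paths, and first countability, which gives local finiteness. -/

/-- The circumradius of the pentagon. -/
noncomputable def circumradius : ℝ := 1 / (2 * Real.sin (Real.pi / 5))

theorem circumradius_pos : 0 < circumradius := by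
  have : 0 < Real.sin (Real.pi / 5) :=
    Real.sin_pos_of_pos_of_lt_pi (by positivity) (by linarith [Real.pi_pos])
  unfold circumradius
  positivity

/-- The cosines of the angles between two corners, in terms of the difference of their numbers. -/
noncomputable def cornerCos : Fin 5 → ℝ :=
  ![1, (√5 - 1) / 4, -(√5 + 1) / 4, -(√5 + 1) / 4, (√5 - 1) / 4]

theorem cos_two_pi_div_five : Real.cos (2 * Real.pi / 5) = (√5 - 1) / 4 := by
  have h5 : √5 ^ 2 = 5 := Real.sq_sqrt (by norm_num)
  rw [show 2 * Real.pi / 5 = 2 * (Real.pi / 5) by ring, Real.cos_two_mul, Real.cos_pi_div_five]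
  linear_combination h5 / 8

theorem cos_four_pi_div_five : Real.cos (4 * Real.pi / 5) = -(√5 + 1) / 4 := by
  rw [show 4 * Real.pi / 5 = Real.pi - Real.pi / 5 by ring, Real.cos_pi_sub,
    Real.cos_pi_div_five]
  ring

theorem two_lt_sqrt_five : 2 < √5 := Real.lt_sqrt_of_sq_lt (by norm_num)

theorem sqrt_five_lt_three : √5 < 3 := (Real.sqrt_lt' (by norm_num)).2 (by norm_num)

theorem pentCorner_eq (k : Fin 5) : pentCorner k =
    ⟨circumradius * Real.cos (2 * Real.pi * (k : ℕ) / 5),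
      circumradius * Real.sin (2 * Real.pi * (k : ℕ) / 5)⟩ := by
  have h : 2 * (Real.pi : ℂ) * Complex.I * ((k : ℕ) : ℂ) / 5
      = ((2 * Real.pi * (k : ℕ) / 5 : ℝ) : ℂ) * Complex.I := by push_cast; ring
  apply Complex.ext
  · rw [pentCorner, h, Complex.re_ofReal_mul, Complex.exp_ofReal_mul_I_re]; rfl
  · rw [pentCorner, h, Complex.im_ofReal_mul, Complex.exp_ofReal_mul_I_im]; rfl

theorem inner_pentCorner (i j : Fin 5) :
    ⟪pentCorner i, pentCorner j⟫ = circumradius ^ 2 * cornerCos (i - j) := by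
  have h : ⟪pentCorner i, pentCorner j⟫ = circumradius ^ 2 *
      Real.cos (2 * Real.pi * (i : ℕ) / 5 - 2 * Real.pi * (j : ℕ) / 5) := by
    rw [pentCorner_eq, pentCorner_eq, Complex.inner, Real.cos_sub]
    simp
    ring
  rw [h]
  congr 1
  have k2 := cos_two_pi_div_five
  have k4 := cos_four_pi_div_five
  have k6 : Real.cos (6 * Real.pi / 5) = -(√5 + 1) / 4 := by
    rw [← k4, ← Real.cos_two_pi_sub]; congr 1; ring
  have k8 : Real.cos (8 * Real.pi / 5) = (√5 - 1) / 4 := by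
    rw [← k2, ← Real.cos_two_pi_sub]; congr 1; ring
  have key : ∀ m : ℕ, ∀ hm : m < 5, Real.cos (2 * m * Real.pi / 5) = cornerCos ⟨m, hm⟩ := by
    intro m hm
    interval_cases m
    · simp [cornerCos]
    · simpa [cornerCos] using k2
    · norm_num; simpa [cornerCos] using k4
    · norm_num; simpa [cornerCos] using k6
    · norm_num; simpa [cornerCos] using k8
  -- Subtraction in `Fin 5` agrees with that of natural numbers only for j ≤ i; evenness of the
  -- cosine covers the other order.
  have hsymm : ∀ k : Fin 5, cornerCos (-k) = cornerCos k := by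
    intro k; fin_cases k <;> simp [cornerCos, Fin.neg_def]
  have hle : ∀ i j : Fin 5, j ≤ i →
      Real.cos (2 * Real.pi * (i : ℕ) / 5 - 2 * Real.pi * (j : ℕ) / 5) = cornerCos (i - j) := by
    intro i j hij
    have h1 : ((i - j : Fin 5) : ℕ) = (i : ℕ) - j := Fin.sub_val_of_le hij
    have h2 := key (i - j : Fin 5) (i - j : Fin 5).2
    rw [Fin.eta, h1, Nat.cast_sub hij] at h2
    rw [← h2]
    congr 1; ring
  rcases le_total j i with hij | hij
  · exact hle i j hij
  · rw [← Real.cos_neg, neg_sub, hle j i hij, ← hsymm, neg_sub]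

theorem norm_pentCorner_sq (k : Fin 5) : ‖pentCorner k‖ ^ 2 = circumradius ^ 2 := by
  rw [← real_inner_self_eq_norm_sq, inner_pentCorner]
  simp [cornerCos]

theorem norm_pentCorner (k : Fin 5) : ‖pentCorner k‖ = circumradius :=
  (sq_eq_sq₀ (norm_nonneg _) circumradius_pos.le).1 (norm_pentCorner_sq k)

theorem sidePoint_eq_smul (i : Fin 5) (s : ℝ) :
    sidePoint i s = (1 - s) • pentCorner i + s • pentCorner (i + 1) := by
  simp [sidePoint]

theorem sidePoint_zero (i : Fin 5) : sidePoint i 0 = pentCorner i := by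
  simp [sidePoint]

theorem pentagon_mem_of_inner_le {n : ℂ} {c : ℝ} (h : ∀ k, ⟪n, pentCorner k⟫ ≤ c) {p : ℂ}
    (hp : p ∈ pentagon) : ⟪n, p⟫ ≤ c := by
  have h1 : Convex ℝ {q : ℂ | ⟪n, q⟫ ≤ c} :=
    convex_halfSpace_le (innerₗ ℂ n).isLinear c
  exact convexHull_min (by rintro _ ⟨k, rfl⟩; exact h k) h1 hp

/-- The points of the pentagon on one of the sides. -/
def sides : Set ℂ := {z | ∃ (i : Fin 5) (s : ℝ), s ∈ Set.Icc (0 : ℝ) 1 ∧ z = sidePoint i s}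

theorem isCompact_sides : IsCompact sides := by
  have h : sides = ⋃ i, sidePoint i '' Set.Icc (0 : ℝ) 1 := by
    ext z
    simp [sides, eq_comm]
  rw [h]
  refine isCompact_iUnion fun i => isCompact_Icc.image ?_
  unfold sidePoint
  fun_prop

theorem cornerCos_add_le (k : Fin 5) :
    cornerCos k + cornerCos (k + 1) ≤ cornerCos 0 + cornerCos 1 := by
  have h1 := two_lt_sqrt_five
  have h2 := sqrt_five_lt_three
  fin_cases k <;> simp [cornerCos] <;> linarith

/-- Each side lies on a supporting line: the inner product with the sum n of its two end corners
attains its maximum over the pentagon there, so a small step in the direction n leaves the pentagon.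
-/
theorem not_mem_interior_of_mem_sides {p : ℂ} (hp : p ∈ sides) : p ∉ interior pentagon := by
  obtain ⟨i, s, hs, rfl⟩ := hp
  intro hp
  set n := pentCorner i + pentCorner (i + 1) with hn
  set c := circumradius ^ 2 * (cornerCos 0 + cornerCos 1) with hc
  have hcpos : 0 < c := by
    have h1 := two_lt_sqrt_five
    have := circumradius_pos
    have : 0 < cornerCos 0 + cornerCos 1 := by simp [cornerCos]; linarith
    positivity
  have hle : ∀ k, ⟪n, pentCorner k⟫ ≤ c := by
    intro k
    rw [hn, inner_add_left, inner_pentCorner, inner_pentCorner, ← mul_add]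
    refine mul_le_mul_of_nonneg_left ?_ (sq_nonneg _)
    have := cornerCos_add_le (i - k)
    rwa [show i - k + 1 = i + 1 - k by abel] at this
  have h4 : cornerCos 4 = cornerCos 1 := by simp [cornerCos]
  have hside : ⟪n, sidePoint i s⟫ = c := by
    rw [sidePoint_eq_smul, hn, inner_add_left, inner_add_right, inner_add_right]
    simp only [inner_smul_right, inner_pentCorner]
    rw [sub_self, sub_self, show i - (i + 1) = 4 by rw [sub_add_cancel_left]; rfl,
      show i + 1 - i = 1 by abel, h4, hc]
    ring
  have hn0 : n ≠ 0 := by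
    intro h
    rw [h, inner_zero_left] at hside
    exact hcpos.ne hside
  have hcont : Filter.Tendsto (fun δ : ℝ => sidePoint i s + δ • n) (nhds 0)
      (nhds (sidePoint i s)) := by
    have : Continuous fun δ : ℝ => sidePoint i s + δ • n := by fun_prop
    simpa using this.tendsto 0
  have hev := (hcont.eventually (mem_interior_iff_mem_nhds.1 hp)).filter_mono
    (nhdsWithin_le_nhds (s := Set.Ioi 0))
  obtain ⟨δ, hδ, hδ0⟩ := (hev.and self_mem_nhdsWithin).exists
  have h1 := pentagon_mem_of_inner_le hle hδ
  rw [inner_add_right, hside, inner_smul_right, real_inner_self_eq_norm_sq] at h1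
  have h2 : 0 < ‖n‖ := norm_pos_iff.2 hn0
  have h3 : 0 < δ := hδ0
  nlinarith [mul_pos h3 (pow_pos h2 2)]

/-- Used twice: the pentagon has interior points, and a linear symmetry is determined by its effect
on the corners. -/
theorem span_pentCorner :
    Submodule.span ℝ {pentCorner 1 - pentCorner 0, pentCorner 4 - pentCorner 0} = ⊤ := by
  have hR := circumradius_pos
  have h5 := sqrt_five_lt_three
  have hs : 0 < Real.sin (2 * Real.pi / 5) :=
    Real.sin_pos_of_pos_of_lt_pi (by positivity) (by linarith [Real.pi_pos])
  have hc : Real.cos (2 * Real.pi / 5) - 1 < 0 := by rw [cos_two_pi_div_five]; linarith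
  have e1 : pentCorner 1 - pentCorner 0 = ⟨circumradius * (Real.cos (2 * Real.pi / 5) - 1),
      circumradius * Real.sin (2 * Real.pi / 5)⟩ := by
    rw [pentCorner_eq, pentCorner_eq]
    apply Complex.ext <;> simp [mul_sub]
  have e4 : pentCorner 4 - pentCorner 0 = ⟨circumradius * (Real.cos (2 * Real.pi / 5) - 1),
      -(circumradius * Real.sin (2 * Real.pi / 5))⟩ := by
    have h8 : 2 * Real.pi * 4 / 5 = 2 * Real.pi - 2 * Real.pi / 5 := by ring
    rw [pentCorner_eq, pentCorner_eq]
    apply Complex.ext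
    · simp [mul_sub, h8, Real.cos_two_pi_sub]
    · simp [h8, Real.sin_two_pi_sub]
  rw [eq_top_iff, e1, e4]
  rintro z -
  refine Submodule.mem_span_pair.2
    ⟨(z.re / (circumradius * (Real.cos (2 * Real.pi / 5) - 1)) +
        z.im / (circumradius * Real.sin (2 * Real.pi / 5))) / 2,
      (z.re / (circumradius * (Real.cos (2 * Real.pi / 5) - 1)) -
        z.im / (circumradius * Real.sin (2 * Real.pi / 5))) / 2, ?_⟩
  have h1 := (mul_neg_of_pos_of_neg hR hc).ne
  have h2 := (mul_pos hR hs).ne'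
  generalize circumradius * (Real.cos (2 * Real.pi / 5) - 1) = a at h1 ⊢
  generalize circumradius * Real.sin (2 * Real.pi / 5) = b at h2 ⊢
  apply Complex.ext
  · simp
    field_simp
    ring
  · simp
    field_simp
    ring

theorem interior_pentagon_nonempty : (interior pentagon).Nonempty := by
  rw [pentagon, interior_convexHull_nonempty_iff_affineSpan_eq_top,
    AffineSubspace.affineSpan_eq_top_iff_vectorSpan_eq_top_of_nonempty ℝ ℂ ℂ
      (Set.range_nonempty _), eq_top_iff, ← span_pentCorner, Submodule.span_le]
  rintro _ (rfl | rfl) <;>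
    exact vsub_mem_vectorSpan ℝ (Set.mem_range_self _) (Set.mem_range_self _)

theorem pentCorner_mem_closure_interior (k : Fin 5) : pentCorner k ∈ closure (interior pentagon) := by
  rw [pentagon, (convex_convexHull ℝ _).closure_interior_eq_closure_of_nonempty_interior
    (by exact interior_pentagon_nonempty)]
  exact subset_closure (cornerPt k).2

/-- If p were no corner, then by strict Cauchy–Schwarz the open half-plane of points q with ⟪p, q⟫ <
R² would contain all corners, hence their convex hull and p itself. Consequently symmetries, which
preserve the norm, permute the corners. -/
theorem exists_eq_pentCorner {p : ℂ} (hp : p ∈ pentagon) (hn : ‖p‖ = circumradius) :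
    ∃ k, p = pentCorner k := by
  by_contra! h
  have h1 : Convex ℝ {q : ℂ | ⟪p, q⟫ < circumradius ^ 2} :=
    convex_halfSpace_lt (innerₗ ℂ p).isLinear _
  have h2 : p ∈ {q : ℂ | ⟪p, q⟫ < circumradius ^ 2} := by
    refine convexHull_min ?_ h1 hp
    rintro _ ⟨k, rfl⟩
    have h3 : 0 < ‖p - pentCorner k‖ := norm_pos_iff.2 (sub_ne_zero.2 (h k))
    have h4 := norm_sub_sq_real p (pentCorner k)
    rw [hn, norm_pentCorner] at h4
    have := pow_pos h3 2
    simp only [Set.mem_ofPred_eq]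
    linarith
  rw [Set.mem_ofPred_eq, real_inner_self_eq_norm_sq, hn] at h2
  exact h2.false

/-! ### Symmetries of the pentagon and their action on the corners. -/

theorem image_interior_pentagon (g : PentSymm) :
    (g : ℂ ≃ₗᵢ[ℝ] ℂ) '' interior pentagon = interior pentagon := by
  have h2 := (g : ℂ ≃ₗᵢ[ℝ] ℂ).toHomeomorph.image_interior pentagon
  have h4 : (g : ℂ ≃ₗᵢ[ℝ] ℂ).toHomeomorph '' pentagon = pentagon := g.2
  rw [h4] at h2
  exact h2

theorem symmAct_mem_interior (g : PentSymm) {p : pentagon} (hp : (p : ℂ) ∈ interior pentagon) :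
    (symmAct g p : ℂ) ∈ interior pentagon := by
  rw [← image_interior_pentagon g]
  exact Set.mem_image_of_mem _ hp

theorem dist_symmAct (g : PentSymm) (p q : pentagon) :
    dist (symmAct g p) (symmAct g q) = dist p q :=
  (g : ℂ ≃ₗᵢ[ℝ] ℂ).dist_map p q

theorem symmAct_symmAct_inv (g : PentSymm) (p : pentagon) : symmAct g (symmAct g⁻¹ p) = p :=
  Subtype.ext ((g : ℂ ≃ₗᵢ[ℝ] ℂ).apply_symm_apply p)

theorem exists_symmAct_cornerPt (g : PentSymm) (i : Fin 5) :
    ∃ j, symmAct g (cornerPt i) = cornerPt j := by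
  obtain ⟨j, hj⟩ := exists_eq_pentCorner (symmAct g (cornerPt i)).2
    (((g : ℂ ≃ₗᵢ[ℝ] ℂ).norm_map _).trans (norm_pentCorner i))
  exact ⟨j, Subtype.ext hj⟩

/-- The permutation of the corners induced by a symmetry. -/
noncomputable def cornerMap (g : PentSymm) (i : Fin 5) : Fin 5 :=
  (exists_symmAct_cornerPt g i).choose

theorem symmAct_cornerPt (g : PentSymm) (i : Fin 5) :
    symmAct g (cornerPt i) = cornerPt (cornerMap g i) :=
  (exists_symmAct_cornerPt g i).choose_spec

/-- A symmetry maps adjacent corners to adjacent corners. -/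
theorem cornerMap_add_one (g : PentSymm) (i : Fin 5) :
    cornerMap g (i + 1) = cornerMap g i + 1 ∨ cornerMap g i = cornerMap g (i + 1) + 1 := by
  have h (k : Fin 5) : (g : ℂ ≃ₗᵢ[ℝ] ℂ) (pentCorner k) = pentCorner (cornerMap g k) :=
    congrArg Subtype.val (symmAct_cornerPt g k)
  have h1 := (g : ℂ ≃ₗᵢ[ℝ] ℂ).inner_map_map (pentCorner (i + 1)) (pentCorner i)
  rw [h, h, inner_pentCorner, inner_pentCorner, add_sub_cancel_left] at h1
  have h2 := mul_left_cancel₀ (pow_pos circumradius_pos 2).ne' h1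
  -- The inner product of two corners tells adjacent pairs from all others.
  have h3 : ∀ k : Fin 5, cornerCos k = cornerCos 1 → k = 1 ∨ -k = 1 := by
    have := sqrt_five_lt_three
    have := two_lt_sqrt_five
    intro k hk
    fin_cases k
    · simp [cornerCos] at hk; linarith
    · simp
    · simp [cornerCos] at hk; linarith
    · simp [cornerCos] at hk; linarith
    · right; rfl
  rcases h3 _ h2 with h | h
  · exact Or.inl (sub_eq_iff_eq_add'.1 h)
  · exact Or.inr (sub_eq_iff_eq_add'.1 ((neg_sub _ _).symm.trans h))

instance : Finite PentSymm := by
  refine Finite.of_injective cornerMap fun g h hgh => ?_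
  have key (k : Fin 5) : (g : ℂ ≃ₗᵢ[ℝ] ℂ) (pentCorner k) = (h : ℂ ≃ₗᵢ[ℝ] ℂ) (pentCorner k) := by
    have := symmAct_cornerPt g k
    rw [hgh, ← symmAct_cornerPt h k] at this
    exact congrArg Subtype.val this
  have h1 : ((g : ℂ ≃ₗᵢ[ℝ] ℂ) : ℂ →ₗ[ℝ] ℂ) = ((h : ℂ ≃ₗᵢ[ℝ] ℂ) : ℂ →ₗ[ℝ] ℂ) := by
    refine LinearMap.ext_on span_pentCorner ?_
    rintro _ (rfl | rfl)
    · simp [key]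
    · simp [key]
  exact Subtype.ext (LinearIsometryEquiv.ext fun z => congrArg (fun f : ℂ →ₗ[ℝ] ℂ => f z) h1)

/-- A function on the pentagon that is affine on the sides, `1` at the corner `k` and `0` at the
other corners. -/
noncomputable def hat (k : Fin 5) (p : ℂ) : ℝ :=
  max 0 ((⟪pentCorner k, p⟫ - circumradius ^ 2 * cornerCos 1) /
    (circumradius ^ 2 * (1 - cornerCos 1)))

theorem cornerCos_one_lt : cornerCos 1 < 1 := by
  have := sqrt_five_lt_three
  simp [cornerCos]; linarith

theorem hat_nonneg (k : Fin 5) (p : ℂ) : 0 ≤ hat k p := le_max_left _ _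

/-- The affine function inside the maximum is 1 at the corner k, 0 at its two neighbours and
negative at the two remaining corners. Truncation at 0 thus gives the barycentric coordinate on
every side. -/
theorem hat_sidePoint (k j : Fin 5) {s : ℝ} (hs : s ∈ Set.Icc (0 : ℝ) 1) :
    hat k (sidePoint j s) = (if k = j then 1 - s else 0) + if k = j + 1 then s else 0 := by
  have hR := pow_pos circumradius_pos 2
  have h1 := sub_pos.2 cornerCos_one_lt
  have e : (⟪pentCorner k, sidePoint j s⟫ - circumradius ^ 2 * cornerCos 1) /
      (circumradius ^ 2 * (1 - cornerCos 1)) =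
      ((1 - s) * cornerCos (k - j) + s * cornerCos (k - j - 1) - cornerCos 1) /
        (1 - cornerCos 1) := by
    rw [sidePoint_eq_smul, inner_add_right, inner_smul_right, inner_smul_right, inner_pentCorner,
      inner_pentCorner, sub_sub k j 1, ← mul_div_mul_left _ (1 - cornerCos 1) hR.ne']
    congr 1
    ring
  rw [hat, e]
  obtain ⟨d, rfl⟩ : ∃ d, k = j + d := ⟨k - j, by abel⟩
  simp only [add_sub_cancel_left, add_right_inj, add_eq_left]
  obtain ⟨hs0, hs1⟩ := hs
  have k1 := two_lt_sqrt_five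
  have neg : ∀ x, x ≤ 0 → max 0 (x / (1 - cornerCos 1)) = 0 := fun x hx =>
    max_eq_left (div_nonpos_of_nonpos_of_nonneg hx h1.le)
  have c0 : cornerCos 0 = 1 := rfl
  have c41 : cornerCos 4 = cornerCos 1 := rfl
  have c32 : cornerCos 3 = cornerCos 2 := rfl
  have c21 : cornerCos 2 ≤ cornerCos 1 := by simp [cornerCos]; linarith
  fin_cases d
  · simp only [Fin.zero_eta, zero_sub, c0, show (-1 : Fin 5) = 4 from rfl, c41]
    rw [show (1 - s) * 1 + s * cornerCos 1 - cornerCos 1 = (1 - s) * (1 - cornerCos 1) by ring,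
      mul_div_cancel_right₀ _ h1.ne']
    simp [hs1]
  · simp only [Fin.mk_one, sub_self, c0]
    rw [show (1 - s) * cornerCos 1 + s * 1 - cornerCos 1 = s * (1 - cornerCos 1) by ring,
      mul_div_cancel_right₀ _ h1.ne']
    simp [hs0]
  · rw [show (⟨2, by norm_num⟩ : Fin 5) = 2 from rfl, show (2 : Fin 5) - 1 = 1 from rfl, neg]
    · simp
    · nlinarith
  · rw [show (⟨3, by norm_num⟩ : Fin 5) = 3 from rfl, show (3 : Fin 5) - 1 = 2 from rfl, neg]
    · simp
    · rw [c32]; nlinarith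
  · rw [show (⟨4, by norm_num⟩ : Fin 5) = 4 from rfl, show (4 : Fin 5) - 1 = 3 from rfl, neg]
    · simp
    · rw [c32, c41]; nlinarith

/-- A Lipschitz constant of the functions `hat k`. -/
noncomputable def hatLip : ℝ := circumradius / (circumradius ^ 2 * (1 - cornerCos 1))

theorem hatLip_pos : 0 < hatLip := by
  have h1 := sub_pos.2 cornerCos_one_lt
  have := circumradius_pos
  unfold hatLip
  positivity

theorem abs_hat_sub_le (k : Fin 5) (p q : ℂ) : |hat k p - hat k q| ≤ hatLip * dist p q := by
  have h1 := sub_pos.2 cornerCos_one_lt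
  have hR := circumradius_pos
  refine (abs_max_sub_max_le_max _ _ _ _).trans ?_
  rw [sub_self, abs_zero, max_eq_right (abs_nonneg _), ← sub_div, sub_sub_sub_cancel_right,
    ← inner_sub_right, abs_div, abs_of_pos (by positivity : 0 < circumradius ^ 2 * (1 - cornerCos 1)),
    hatLip, div_mul_eq_mul_div]
  gcongr
  refine (abs_real_inner_le_norm _ _).trans ?_
  rw [norm_pentCorner, dist_eq_norm]

namespace PentComplex

variable {C : PentComplex}

theorem exists_pt (y : C.Aff) : ∃ t p, y = C.pt t p := by
  obtain ⟨⟨t, p⟩, rfl⟩ := Quot.exists_rep y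
  exact ⟨t, p, rfl⟩

/-! ### Paths and the path metric -/

theorem Path.nonneg {a b : C.Aff} {l : ℝ} (h : C.Path a b l) : 0 ≤ l := by
  induction h with
  | nil => exact le_rfl
  | cons t p q _ ih => exact add_nonneg dist_nonneg ih

theorem Path.segment (t : C.T) (p q : pentagon) : C.Path (C.pt t p) (C.pt t q) (dist p q) := by
  simpa using Path.cons t p q (Path.nil (C.pt t q))

theorem Path.trans {a b c : C.Aff} {l m : ℝ} (h : C.Path a b l) (h' : C.Path b c m) :
    C.Path a c (l + m) := by
  induction h with
  | nil => simpa using h'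
  | cons t p q _ ih => rw [add_assoc]; exact Path.cons t p q (ih h')

theorem Path.symm {a b : C.Aff} {l : ℝ} (h : C.Path a b l) : C.Path b a l := by
  induction h with
  | nil => exact Path.nil _
  | cons t p q _ ih =>
    rw [add_comm, dist_comm]
    exact ih.trans (Path.segment t q p)

theorem affDist_nonneg (a b : C.Aff) : 0 ≤ C.affDist a b :=
  Real.sInf_nonneg fun _ h => Path.nonneg h

theorem bddBelow_path (a b : C.Aff) : BddBelow {l | C.Path a b l} :=
  ⟨0, fun _ h => Path.nonneg h⟩

theorem Path.affDist_le {a b : C.Aff} {l : ℝ} (h : C.Path a b l) : C.affDist a b ≤ l :=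
  csInf_le (bddBelow_path a b) h

theorem affDist_comm (a b : C.Aff) : C.affDist a b = C.affDist b a := by
  unfold affDist
  congr 1
  ext l
  exact ⟨Path.symm, Path.symm⟩

theorem affDist_self (a : C.Aff) : C.affDist a a = 0 :=
  le_antisymm (Path.nil a).affDist_le (affDist_nonneg a a)

/-- Any two points can be joined by a path. -/
def PathConnected (C : PentComplex) : Prop := ∀ a b : C.Aff, ∃ l, C.Path a b l

theorem PathConnected.exists_path_lt (hC : C.PathConnected) {a b : C.Aff} {r : ℝ}
    (h : C.affDist a b < r) : ∃ l < r, C.Path a b l := by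
  obtain ⟨l, hl, hr⟩ := exists_lt_of_csInf_lt (hC a b) h
  exact ⟨l, hr, hl⟩

theorem PathConnected.affDist_triangle (hC : C.PathConnected) (a b c : C.Aff) :
    C.affDist a c ≤ C.affDist a b + C.affDist b c := by
  refine le_of_forall_pos_le_add fun ε hε => ?_
  obtain ⟨l, hl, h⟩ := hC.exists_path_lt (lt_add_of_pos_right (C.affDist a b) (half_pos hε))
  obtain ⟨m, hm, h'⟩ := hC.exists_path_lt (lt_add_of_pos_right (C.affDist b c) (half_pos hε))
  linarith [(h.trans h').affDist_le]

/-- A set that contains every tile it meets is open in the CW topology. The set of points reachable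
from a, and its complement, are of this kind, so the former is clopen. -/
theorem pathConnected_of_preconnected [PreconnectedSpace C.Aff] : C.PathConnected := by
  have hopen : ∀ S : Set C.Aff, (∀ t p q, C.pt t p ∈ S → C.pt t q ∈ S) → IsOpen S := by
    intro S hS
    change IsOpen (Quot.mk C.Glue ⁻¹' S)
    rw [isOpen_sigma_iff]
    intro t
    by_cases h : ∃ p, C.pt t p ∈ S
    · obtain ⟨p, hp⟩ := h
      convert isOpen_univ
      exact Set.eq_univ_of_forall fun q => hS t p q hp
    · convert isOpen_empty
      exact Set.eq_empty_of_forall_notMem fun q hq => h ⟨q, hq⟩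
  intro a b
  have hclopen : IsClopen {y | ∃ l, C.Path a y l} := by
    refine ⟨⟨hopen _ ?_⟩, hopen _ ?_⟩
    · rintro t p q hp ⟨l, hl⟩
      exact hp ⟨_, hl.trans (Path.segment t q p)⟩
    · rintro t p q ⟨l, hl⟩
      exact ⟨_, hl.trans (Path.segment t p q)⟩
  have := hclopen.eq_univ ⟨a, 0, Path.nil a⟩
  exact this.symm.subset (Set.mem_univ b)

theorem Path.abs_sub_le {f : C.Aff → ℝ} {c : ℝ}
    (hf : ∀ t p q, |f (C.pt t p) - f (C.pt t q)| ≤ c * dist p q) {a b : C.Aff} {l : ℝ}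
    (h : C.Path a b l) : |f a - f b| ≤ c * l := by
  induction h with
  | nil => simp
  | @cons t p q b l _ ih =>
    rw [mul_add]
    exact (_root_.abs_sub_le _ (f (C.pt t q)) _).trans (add_le_add (hf t p q) ih)

/-- Tilewise Lipschitz functions on the pasted space cannot distinguish points at distance zero;
suitable choices of f will show that such points coincide. -/
theorem PathConnected.eq_of_affDist_eq_zero (hC : C.PathConnected) {f : C.Aff → ℝ} {c : ℝ}
    (hc : 0 < c) (hf : ∀ t p q, |f (C.pt t p) - f (C.pt t q)| ≤ c * dist p q) {a b : C.Aff}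
    (h : C.affDist a b = 0) : f a = f b := by
  by_contra hne
  have hpos : 0 < |f a - f b| / c := div_pos (abs_pos.2 (sub_ne_zero.2 hne)) hc
  obtain ⟨l, hl, hp⟩ := hC.exists_path_lt (h.trans_lt hpos)
  have := hp.abs_sub_le hf
  rw [lt_div_iff₀ hc] at hl
  linarith

/-- A path can be divided at any given length. -/
theorem Path.split {a b : C.Aff} {l r s : ℝ} (h : C.Path a b l) (hr : 0 ≤ r) (hs : 0 ≤ s)
    (hl : l ≤ r + s) :
    ∃ c l₁ l₂, C.Path a c l₁ ∧ C.Path c b l₂ ∧ l₁ ≤ r ∧ l₂ ≤ s := by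
  induction h generalizing r with
  | nil a => exact ⟨a, 0, 0, Path.nil a, Path.nil a, hr, hs⟩
  | @cons t p q b l hp ih =>
    rcases le_total (dist p q) r with hd | hd
    · obtain ⟨c, l₁, l₂, h₁, h₂, h₁r, h₂s⟩ := ih (sub_nonneg.2 hd) (by linarith)
      exact ⟨c, _, l₂, Path.cons t p q h₁, h₂, by linarith, h₂s⟩
    -- For r > 0 the cut falls inside the first segment, at parameter r / dist p q; r = 0 is treated
    -- apart because the segment may then be degenerate.
    · rcases hr.eq_or_lt with rfl | hr'
      · exact ⟨_, 0, _, Path.nil _, Path.cons t p q hp, le_rfl, by linarith⟩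
      have hd0 : 0 < dist p q := hr'.trans_le hd
      have hm : AffineMap.lineMap (p : ℂ) (q : ℂ) (r / dist p q) ∈ pentagon :=
        (convex_convexHull ℝ _).lineMap_mem p.2 q.2
          ⟨by positivity, div_le_one_of_le₀ hd dist_nonneg⟩
      have h1 : dist p ⟨_, hm⟩ = r := by
        rw [Subtype.dist_eq, dist_left_lineMap, ← Subtype.dist_eq, Real.norm_of_nonneg (by positivity)]
        field_simp
      have h2 : dist ⟨_, hm⟩ q = dist p q - r := by
        rw [Subtype.dist_eq, dist_lineMap_right, ← Subtype.dist_eq, Real.norm_of_nonneg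
          (sub_nonneg.2 (div_le_one_of_le₀ hd dist_nonneg))]
        field_simp
      exact ⟨C.pt t ⟨_, hm⟩, _, _, Path.segment t p _, Path.cons t ⟨_, hm⟩ q hp, h1.le, by linarith⟩

/-! ### Functions on the pasted space -/

/-- A function on the tiles whose value at a boundary point depends only on the barycentric
coordinates of the point descends to the pasted space. -/
def liftFun (f : C.T → pentagon → ℝ) (β : (C.V →₀ ℝ) → ℝ)
    (h : ∀ t (p : pentagon) j s, s ∈ Set.Icc (0 : ℝ) 1 → (p : ℂ) = sidePoint j s →
      f t p = β (Finsupp.single (C.corner t j) (1 - s) + Finsupp.single (C.corner t (j + 1)) s)) :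
    C.Aff → ℝ :=
  Quot.lift (fun a => f a.1 a.2) (by
    rintro ⟨t, p⟩ ⟨t', p'⟩ ⟨i, j, s, s', hs, hs', hp, hp', he⟩
    exact (h t p i s hs hp).trans ((congrArg β he).trans (h t' p' j s' hs' hp').symm))

open Classical in
/-- The function `tileCoord v t` on the tile `t` is the barycentric coordinate with respect to `v`
on the boundary. -/
noncomputable def tileCoord (v : C.V) (t : C.T) (p : pentagon) : ℝ :=
  ∑ k, if C.corner t k = v then hat k p else 0

theorem tileCoord_eq_zero {v : C.V} {t : C.T} (h : ∀ k, C.corner t k ≠ v) (p : pentagon) :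
    tileCoord v t p = 0 :=
  Finset.sum_eq_zero fun k _ => if_neg (h k)

theorem abs_tileCoord_sub_le (v : C.V) (t : C.T) (p q : pentagon) :
    |tileCoord v t p - tileCoord v t q| ≤ 5 * hatLip * dist p q := by
  classical
  rw [tileCoord, tileCoord, ← Finset.sum_sub_distrib]
  refine (Finset.abs_sum_le_sum_abs _ _).trans ?_
  calc _ ≤ ∑ _k : Fin 5, hatLip * dist p q := by
        refine Finset.sum_le_sum fun k _ => ?_
        split_ifs
        · exact abs_hat_sub_le k p q
        · simpa using mul_nonneg hatLip_pos.le dist_nonneg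
    _ = _ := by simp; ring

/-- The corners of a tile need not be distinct here: summing over all k with corner v adds the hats
of repeated corners, just as the two `Finsupp.single` terms add. -/
theorem tileCoord_side (v : C.V) (t : C.T) (p : pentagon) (j : Fin 5) (s : ℝ)
    (hs : s ∈ Set.Icc (0 : ℝ) 1) (hp : (p : ℂ) = sidePoint j s) :
    tileCoord v t p =
      (Finsupp.single (C.corner t j) (1 - s) + Finsupp.single (C.corner t (j + 1)) s : C.V →₀ ℝ) v := by
  classical
  rw [tileCoord, hp, Finsupp.add_apply, Finsupp.single_apply, Finsupp.single_apply]
  simp only [hat_sidePoint _ j hs]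
  have h (k : Fin 5) : (if C.corner t k = v then
      (if k = j then 1 - s else 0) + (if k = j + 1 then s else 0) else 0) =
      (if k = j then (if C.corner t j = v then 1 - s else 0) else 0) +
        (if k = j + 1 then (if C.corner t (j + 1) = v then s else 0) else 0) := by
    by_cases h1 : k = j <;> by_cases h2 : k = j + 1 <;> simp [h1, h2]
  simp only [h, Finset.sum_add_distrib, Finset.sum_ite_eq', Finset.mem_univ, if_true]

/-- The barycentric coordinate with respect to the vertex `v`, extended to the tiles. -/
noncomputable def coord (v : C.V) : C.Aff → ℝ :=
  liftFun (tileCoord v) (fun x => x v) (tileCoord_side v)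

theorem coord_pt (v : C.V) (t : C.T) (p : pentagon) : coord v (C.pt t p) = tileCoord v t p := rfl

open Classical in
/-- A function which is `1` on the tile `t` and vanishes on the tiles disjoint from `t`. -/
noncomputable def starFun (t : C.T) : C.Aff → ℝ :=
  liftFun (fun s p => if s = t then 1 else ∑ v ∈ Finset.univ.image (C.corner t), tileCoord v s p)
    (fun x => ∑ v ∈ Finset.univ.image (C.corner t), x v) (by
      intro t' p j s hs hp
      split_ifs with h
      · subst h
        -- On the boundary of t the coordinates at its vertices add up to (1 - s) + s = 1. Summing
        -- over the image counts a repeated corner only once.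
        simp [Finset.sum_add_distrib, Finsupp.single_apply]
      · exact Finset.sum_congr rfl fun v _ => tileCoord_side v t' p j s hs hp)

open Classical in
theorem starFun_pt (t s : C.T) (p : pentagon) : starFun t (C.pt s p) =
    if s = t then 1 else ∑ v ∈ Finset.univ.image (C.corner t), tileCoord v s p := rfl

theorem abs_starFun_sub_le (t s : C.T) (p q : pentagon) :
    |starFun t (C.pt s p) - starFun t (C.pt s q)| ≤ 25 * hatLip * dist p q := by
  classical
  have h0 : 0 ≤ hatLip * dist p q := mul_nonneg hatLip_pos.le dist_nonneg
  rw [starFun_pt, starFun_pt]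
  split_ifs
  · simp only [sub_self, abs_zero]; linarith
  · rw [← Finset.sum_sub_distrib]
    refine (Finset.abs_sum_le_sum_abs _ _).trans ?_
    refine (Finset.sum_le_card_nsmul _ _ _ fun v _ => abs_tileCoord_sub_le v s p q).trans ?_
    have hc : (Finset.univ.image (C.corner t)).card ≤ 5 := Finset.card_image_le
    have : ((Finset.univ.image (C.corner t)).card : ℝ) ≤ 5 := by exact_mod_cast hc
    rw [nsmul_eq_mul]
    nlinarith

open Classical in
/-- A bump about a point `p` in the interior of the tile `t`. -/
noncomputable def bump (t : C.T) (p : ℂ) : C.Aff → ℝ :=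
  liftFun (fun s q => if s = t then max 0 (Metric.infDist p sides - dist p q) else 0) (fun _ => 0)
    (by
      intro t' q j s hs hq
      split_ifs
      · refine max_eq_left (sub_nonpos.2 (Metric.infDist_le_dist_of_mem ⟨j, s, hs, hq⟩))
      · rfl)

open Classical in
theorem bump_pt (t : C.T) (p : ℂ) (s : C.T) (q : pentagon) : bump t p (C.pt s q) =
    if s = t then max 0 (Metric.infDist p sides - dist p q) else 0 := rfl

theorem abs_bump_sub_le (t : C.T) (p : ℂ) (s : C.T) (q r : pentagon) :
    |bump t p (C.pt s q) - bump t p (C.pt s r)| ≤ 1 * dist q r := by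
  classical
  rw [bump_pt, bump_pt, one_mul]
  split_ifs
  · refine (abs_max_sub_max_le_max _ _ _ _).trans ?_
    rw [sub_self, abs_zero, max_eq_right (abs_nonneg _), sub_sub_sub_cancel_left, dist_comm q r]
    rw [dist_comm (p : ℂ), dist_comm (p : ℂ)]
    exact abs_dist_sub_le _ _ _
  · simp

/-- A point off the sides of a tile is determined by the value of a bump. -/
theorem eq_of_bump_eq {t s : C.T} {p q : pentagon} (hp : (p : ℂ) ∉ sides)
    (h : bump t p (C.pt t p) = bump t p (C.pt s q)) : t = s ∧ p = q := by
  classical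
  have hpos : 0 < Metric.infDist (p : ℂ) sides :=
    (isCompact_sides.isClosed.notMem_iff_infDist_pos
      ⟨_, 0, 0, ⟨le_rfl, zero_le_one⟩, rfl⟩).1 hp
  rw [bump_pt, bump_pt, if_pos rfl, dist_self, sub_zero, max_eq_right hpos.le] at h
  split_ifs at h with hst
  · refine ⟨hst.symm, Subtype.ext (dist_le_zero.1 ?_)⟩
    rcases max_choice 0 (Metric.infDist (p : ℂ) sides - dist (p : ℂ) q) with hm | hm <;>
      rw [hm] at h <;> linarith
  · exact absurd h hpos.ne'

theorem pt_injective_of_not_mem_sides {t s : C.T} {p q : pentagon} (hp : (p : ℂ) ∉ sides)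
    (h : C.pt t p = C.pt s q) : t = s ∧ p = q :=
  eq_of_bump_eq hp (congrArg _ h)

theorem pt_injective_of_mem_interior {t s : C.T} {p q : pentagon}
    (hp : (p : ℂ) ∈ interior pentagon) (h : C.pt t p = C.pt s q) : t = s ∧ p = q :=
  pt_injective_of_not_mem_sides (fun h' => not_mem_interior_of_mem_sides h' hp) h

theorem corner_eq_of_pt_eq {t s : C.T} {i j : Fin 5}
    (h : C.pt t (cornerPt i) = C.pt s (cornerPt j)) : C.corner t i = C.corner s j := by
  have h0 : (0 : ℝ) ∈ Set.Icc (0 : ℝ) 1 := ⟨le_rfl, zero_le_one⟩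
  have h1 := congrArg (coord (C.corner t i)) h
  rw [coord_pt, coord_pt, tileCoord_side _ t _ i 0 h0 (sidePoint_zero i).symm,
    tileCoord_side _ s _ j 0 h0 (sidePoint_zero j).symm] at h1
  by_contra hne
  simp [Ne.symm hne] at h1

theorem pt_cornerPt_eq {t s : C.T} {i j : Fin 5} (h : C.corner t i = C.corner s j) :
    C.pt t (cornerPt i) = C.pt s (cornerPt j) := by
  refine Quot.sound ⟨i, j, 0, 0, ⟨le_rfl, zero_le_one⟩, ⟨le_rfl, zero_le_one⟩,
    (sidePoint_zero i).symm, (sidePoint_zero j).symm, ?_⟩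
  simp [h]

/-- The path metric separates points. -/
theorem PathConnected.eq_of_affDist (hC : C.PathConnected) {a b : C.Aff}
    (h : C.affDist a b = 0) : a = b := by
  obtain ⟨t, p, rfl⟩ := exists_pt a
  obtain ⟨s, q, rfl⟩ := exists_pt b
  by_cases hp : (p : ℂ) ∈ sides
  · by_cases hq : (q : ℂ) ∈ sides
    · obtain ⟨i, u, hu, hpu⟩ := hp
      obtain ⟨j, v, hv, hqv⟩ := hq
      -- For boundary points, pasting means equality of all barycentric coordinates, and each
      -- coordinate is a Lipschitz test function.
      refine Quot.sound ⟨i, j, u, v, hu, hv, hpu, hqv, Finsupp.ext fun w => ?_⟩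
      rw [← tileCoord_side w t p i u hu hpu, ← tileCoord_side w s q j v hv hqv, ← coord_pt,
        ← coord_pt]
      exact hC.eq_of_affDist_eq_zero (by linarith [hatLip_pos]) (abs_tileCoord_sub_le w) h
    · rw [affDist_comm] at h
      obtain ⟨rfl, rfl⟩ := eq_of_bump_eq hq
        (hC.eq_of_affDist_eq_zero one_pos (abs_bump_sub_le s q) h)
      rfl
  · obtain ⟨rfl, rfl⟩ := eq_of_bump_eq hp
      (hC.eq_of_affDist_eq_zero one_pos (abs_bump_sub_le t p) h)
    rfl

/-! ### Finiteness of balls -/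

/-- Every vertex is a corner of finitely many tiles only. -/
def LocallyFinite (C : PentComplex) : Prop := ∀ v : C.V, {t | ∃ i, C.corner t i = v}.Finite

theorem continuous_pt (t : C.T) : Continuous (C.pt t) :=
  continuous_quot_mk.comp continuous_sigmaMk

/-- A complex with first countable CW topology is locally finite: otherwise there were a sequence of
interior points of distinct tiles converging to a vertex, although such a sequence is closed. -/
theorem locallyFinite_of_firstCountable [FirstCountableTopology C.Aff] : C.LocallyFinite := by
  intro v
  by_contra hinf
  have hinf : {t | ∃ i, C.corner t i = v}.Infinite := hinf
  set τ : ℕ → C.T := fun n => (hinf.natEmbedding _ n : C.T) with hτ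
  have hτinj : Function.Injective τ := Subtype.val_injective.comp (hinf.natEmbedding _).injective
  have hcor : ∀ n, ∃ i, C.corner (τ n) i = v := fun n => (hinf.natEmbedding _ n).2
  choose i hi using hcor
  set V := C.pt (τ 0) (cornerPt (i 0)) with hV
  have hVn : ∀ n, C.pt (τ n) (cornerPt (i n)) = V := fun n => pt_cornerPt_eq ((hi n).trans (hi 0).symm)
  obtain ⟨U, hU⟩ := (nhds V).exists_antitone_basis
  have hex : ∀ n, ∃ p : pentagon, (p : ℂ) ∈ interior pentagon ∧ C.pt (τ n) p ∈ U n := by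
    intro n
    have h1 : C.pt (τ n) ⁻¹' U n ∈ nhds (cornerPt (i n)) := by
      refine (continuous_pt (τ n)).continuousAt ?_
      rw [hVn]
      exact hU.mem n
    obtain ⟨W, hW, hWU⟩ := mem_nhds_subtype _ _ _ |>.1 h1
    obtain ⟨z, hzW, hz⟩ := mem_closure_iff_nhds.1 (pentCorner_mem_closure_interior (i n)) W hW
    exact ⟨⟨z, interior_subset hz⟩, hz, hWU hzW⟩
  choose p hp hpU using hex
  have hlim : Filter.Tendsto (fun n => C.pt (τ n) (p n)) Filter.atTop (nhds V) := hU.tendsto hpU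
  have hopen : IsOpen (Set.range fun n => C.pt (τ n) (p n))ᶜ := by
    change IsOpen (Quot.mk C.Glue ⁻¹' _)
    rw [isOpen_sigma_iff]
    intro t
    -- The chosen points are interior to distinct tiles, so every tile contains at most one of them
    -- and their set is closed.
    have hsub : {q : pentagon | C.pt t q ∈ Set.range fun n => C.pt (τ n) (p n)}.Subsingleton := by
      rintro q ⟨n, hn⟩ r ⟨m, hm⟩
      obtain ⟨h1, rfl⟩ := pt_injective_of_mem_interior (hp n) hn
      obtain ⟨h2, rfl⟩ := pt_injective_of_mem_interior (hp m) hm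
      rw [hτinj (h1.trans h2.symm)]
    exact hsub.isClosed.isOpen_compl
  have hmem : V ∈ (Set.range fun n => C.pt (τ n) (p n))ᶜ := by
    rintro ⟨n, hn⟩
    have h1 := pt_injective_of_mem_interior (hp n) (hn.trans (hVn n).symm)
    refine not_mem_interior_of_mem_sides ⟨i n, 0, ⟨le_rfl, zero_le_one⟩, ?_⟩ (hp n)
    rw [h1.2, sidePoint_zero]
    rfl
  obtain ⟨n, hn⟩ := (hlim.eventually (hopen.mem_nhds hmem)).exists
  exact hn ⟨n, rfl⟩

/-- The tiles that can be reached from `a` by a path of length at most `r`. -/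
def reach (C : PentComplex) (a : C.Aff) (r : ℝ) : Set C.T :=
  {t | ∃ p l, l ≤ r ∧ C.Path a (C.pt t p) l}

/-- A short path starting in `t` ends in a tile with a common vertex. -/
theorem Path.exists_common_corner {t s : C.T} {p q : pentagon} {l : ℝ}
    (h : C.Path (C.pt t p) (C.pt s q) l) (hl : 25 * hatLip * l < 1) :
    s = t ∨ ∃ k i, C.corner s k = C.corner t i := by
  classical
  by_contra! hne
  have h1 := h.abs_sub_le (abs_starFun_sub_le t)
  -- Without a common corner `starFun t` would drop from 1 to 0 along the path, but it changes by at
  -- most 25 * hatLip * l < 1.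
  rw [starFun_pt, starFun_pt, if_pos rfl, if_neg hne.1, Finset.sum_eq_zero] at h1
  · norm_num at h1; linarith
  · intro v hv
    obtain ⟨i, -, rfl⟩ := Finset.mem_image.1 hv
    exact tileCoord_eq_zero (fun k => hne.2 k i) q

/-- Cut a path into pieces of length at most c, half the threshold of `Path.exists_common_corner`.
Each piece leads from a tile to itself or to one of its finitely many neighbours. -/
theorem LocallyFinite.finite_reach (hC : C.LocallyFinite) (a : C.Aff) (r : ℝ) :
    (C.reach a r).Finite := by
  set c := 1 / (50 * hatLip) with hc
  have hL := hatLip_pos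
  have hcpos : 0 < c := by positivity
  have hcl : 25 * hatLip * c < 1 := by rw [hc]; field_simp; norm_num
  have hnbr : ∀ t : C.T, {s | s = t ∨ ∃ k i, C.corner s k = C.corner t i}.Finite := by
    intro t
    refine ((Set.finite_singleton t).union
      (Set.finite_iUnion fun i => hC (C.corner t i))).subset ?_
    rintro s (rfl | ⟨k, i, h⟩)
    · exact Or.inl rfl
    · exact Or.inr (Set.mem_iUnion.2 ⟨i, k, h⟩)
  have key : ∀ n : ℕ, (C.reach a (n * c)).Finite := by
    intro n
    induction n with
    | zero =>
      obtain ⟨t, p, rfl⟩ := exists_pt a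
      refine (hnbr t).subset ?_
      rintro s ⟨q, l, hl, h⟩
      refine h.exists_common_corner ?_
      simp only [Nat.cast_zero, zero_mul] at hl
      nlinarith
    | succ n ih =>
      refine (ih.biUnion fun t _ => hnbr t).subset ?_
      rintro s ⟨q, l, hl, h⟩
      obtain ⟨b, l₁, l₂, h₁, h₂, hl₁, hl₂⟩ := h.split (r := n * c) (s := c) (by positivity) hcpos.le
        (by push_cast at hl; linarith)
      obtain ⟨t, p, rfl⟩ := exists_pt b
      refine Set.mem_biUnion (show t ∈ C.reach a (n * c) from ⟨p, l₁, hl₁, h₁⟩)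
        (h₂.exists_common_corner ?_)
      have := mul_le_mul_of_nonneg_left hl₂ (by positivity : 0 ≤ 25 * hatLip)
      linarith
  obtain ⟨n, hn⟩ := exists_nat_ge (r / c)
  refine (key n).subset ?_
  rintro t ⟨p, l, hl, h⟩
  exact ⟨p, l, hl.trans ((div_le_iff₀ hcpos).1 hn), h⟩

/-- Only finitely many tiles meet a given ball. -/
theorem finite_tiles_meeting_ball (hC : C.PathConnected) (hC' : C.LocallyFinite) (a : C.Aff)
    (r : ℝ) : {t | ∃ p, C.pt t p ∈ C.ball a r}.Finite := by
  -- The distance is an infimum, so a point of the closed ball need not be joined to a by a path of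
  -- length at most r; hence r + 1.
  refine (hC'.finite_reach a (r + 1)).subset ?_
  rintro t ⟨p, hp⟩
  obtain ⟨l, hl, h⟩ := hC.exists_path_lt (lt_of_le_of_lt (show C.affDist a (C.pt t p) ≤ r from hp)
    (lt_add_one r))
  exact ⟨p, l, hl.le, h⟩

end PentComplex

variable {D : Type u} {L L' L'' : DecComplex D}

/-! ### Composition and restriction of cell-preserving isometries -/

theorem DegreeMapOn.mono {F : L.Aff → L'.Aff} {A B : Set L.Aff} (h : DegreeMapOn L L' F B)
    (hAB : A ⊆ B) : DegreeMapOn L L' F A :=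
  fun t i hi => h t i (hAB hi)

theorem IsometryOn.mono {F : L.Aff → L'.Aff} {A B : Set L.Aff} (h : IsometryOn L L' F B)
    (hAB : A ⊆ B) : IsometryOn L L' F A :=
  fun y hy z hz => h y (hAB hy) z (hAB hz)

theorem DegreeMapOn.comp_mapsTo {F : L.Aff → L'.Aff} {G : L'.Aff → L''.Aff} {B : Set L.Aff}
    {B' : Set L'.Aff} (hF : DegreeMapOn L L' F B) (hG : DegreeMapOn L' L'' G B')
    (hm : Set.MapsTo F B B') : DegreeMapOn L L'' (G ∘ F) B := by
  intro t i hi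
  obtain ⟨t', j, h, hd⟩ := hF t i hi
  have hi' := hm hi
  rw [h] at hi'
  obtain ⟨t'', k, h', hd'⟩ := hG t' j hi'
  exact ⟨t'', k, by rw [Function.comp, h, h'], hd'.trans hd⟩

theorem IsometryOn.comp_mapsTo {F : L.Aff → L'.Aff} {G : L'.Aff → L''.Aff} {B : Set L.Aff}
    {B' : Set L'.Aff} (hF : IsometryOn L L' F B) (hG : IsometryOn L' L'' G B')
    (hm : Set.MapsTo F B B') : IsometryOn L L'' (G ∘ F) B :=
  fun y hy z hz => (hG _ (hm hy) _ (hm hz)).trans (hF y hy z hz)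

theorem IsometryOn.injective {F : L.Aff → L'.Aff} (hF : IsometryOn L L' F Set.univ)
    (hL : L.PathConnected) : Function.Injective F := by
  intro y z h
  refine hL.eq_of_affDist ?_
  rw [← hF y trivial z trivial, h, affDist_self]

variable [MulAction PentSymm D]

theorem CellMapOn.mono {F : L.Aff → L'.Aff} {A B : Set L.Aff} (h : CellMapOn L L' F B)
    (hAB : A ⊆ B) : CellMapOn L L' F A := by
  rintro t ⟨p, hp, hpA⟩
  obtain ⟨t', g, hd, hg⟩ := h t ⟨p, hp, hAB hpA⟩
  exact ⟨t', g, hd, fun q hq => hg q (hAB hq)⟩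

theorem CellMapOn.comp_mapsTo {F : L.Aff → L'.Aff} {G : L'.Aff → L''.Aff} {B : Set L.Aff}
    {B' : Set L'.Aff} (hF : CellMapOn L L' F B) (hG : CellMapOn L' L'' G B')
    (hm : Set.MapsTo F B B') : CellMapOn L L'' (G ∘ F) B := by
  rintro t ⟨p, hp, hpB⟩
  obtain ⟨t', g, hd, hg⟩ := hF t ⟨p, hp, hpB⟩
  obtain ⟨t'', g', hd', hg'⟩ := hG t' ⟨symmAct g p, symmAct_mem_interior g hp,
    by rw [← hg p hpB]; exact hm hpB⟩
  refine ⟨t'', g' * g, by rw [hd', hd, mul_smul], fun q hq => ?_⟩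
  have hq' := hm hq
  rw [hg q hq] at hq'
  rw [Function.comp, hg q hq, hg' _ hq']
  rfl

/-! ### Isomorphisms preserve the path metric and the degrees -/

theorem CellMapOn.exists_tile {F : L.Aff → L'.Aff} (hF : CellMapOn L L' F Set.univ) (t : L.T) :
    ∃ (t' : L'.T) (g : PentSymm), L'.dec t' = g • L.dec t ∧
      ∀ p : pentagon, F (L.pt t p) = L'.pt t' (symmAct g p) := by
  obtain ⟨z, hz⟩ := interior_pentagon_nonempty
  obtain ⟨t', g, hd, hg⟩ := hF t ⟨⟨z, interior_subset hz⟩, hz, trivial⟩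
  exact ⟨t', g, hd, fun p => hg p trivial⟩

theorem CellMapOn.path {F : L.Aff → L'.Aff} (hF : CellMapOn L L' F Set.univ) {a b : L.Aff} {l : ℝ}
    (h : L.Path a b l) : L'.Path (F a) (F b) l := by
  induction h with
  | nil => exact Path.nil _
  | cons t p q _ ih =>
    obtain ⟨t', g, -, hg⟩ := hF.exists_tile t
    rw [hg] at ih ⊢
    rw [← dist_symmAct g]
    exact Path.cons t' _ _ ih

theorem CellMapOn.isometryOn {F : L.Aff ≃ L'.Aff} (hF : CellMapOn L L' F Set.univ)
    (hF' : CellMapOn L' L F.symm Set.univ) : IsometryOn L L' F Set.univ := by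
  intro y _ z _
  unfold affDist
  congr 1
  ext l
  exact ⟨fun h => by simpa using hF'.path h, hF.path⟩

/-- Symmetries preserve adjacency of corners, so neighbours of the vertex go to neighbours of its
image, injectively. As F acts on points, each neighbour is represented as a corner of some tile and
its image is read off there. -/
theorem CellMapOn.degree_le {F : L.Aff → L'.Aff} (hF : CellMapOn L L' F Set.univ)
    (hinj : Function.Injective F) {t : L.T} {i : Fin 5} {t' : L'.T} {j : Fin 5}
    (h : F (L.pt t (cornerPt i)) = L'.pt t' (cornerPt j)) :
    L.degree (L.corner t i) ≤ L'.degree (L'.corner t' j) := by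
  have key : ∀ w, (∃ s k, s(L.corner t i, w) = L.side s k) → ∃ s m s' m', w = L.corner s m ∧
      F (L.pt s (cornerPt m)) = L'.pt s' (cornerPt m') ∧
      ∃ r k, s(L'.corner t' j, L'.corner s' m') = L'.side r k := by
    rintro w ⟨s, k, hw⟩
    obtain ⟨s', g, -, hg⟩ := hF.exists_tile s
    have hc (m : Fin 5) : F (L.pt s (cornerPt m)) = L'.pt s' (cornerPt (cornerMap g m)) := by
      rw [hg, symmAct_cornerPt]
    have hv (m : Fin 5) (hm : L.corner t i = L.corner s m) :
        L'.corner t' j = L'.corner s' (cornerMap g m) := by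
      apply corner_eq_of_pt_eq
      rw [← h, ← hc, pt_cornerPt_eq hm]
    have hside : ∃ r, s(L'.corner s' (cornerMap g k), L'.corner s' (cornerMap g (k + 1))) =
        L'.side s' r := by
      rcases cornerMap_add_one g k with h | h
      · exact ⟨cornerMap g k, by rw [h]; rfl⟩
      · exact ⟨cornerMap g (k + 1), by rw [h, Sym2.eq_swap]; rfl⟩
    obtain ⟨r, hr⟩ := hside
    rcases Sym2.eq_iff.1 hw with ⟨h1, h2⟩ | ⟨h1, h2⟩
    · exact ⟨s, k + 1, s', _, h2, hc _, s', r, by rw [hv _ h1, hr]⟩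
    · exact ⟨s, k, s', _, h2, hc _, s', r, by rw [hv _ h1, Sym2.eq_swap, hr]⟩
  have : Nonempty L.T := ⟨t⟩
  have : Nonempty L'.T := ⟨t'⟩
  choose! s m s' m' h1 h2 h3 using key
  refine Set.encard_le_encard_of_injOn (f := fun w => L'.corner (s' w) (m' w))
    (fun w hw => h3 w hw) ?_
  intro w hw w' hw' he
  have h4 := pt_cornerPt_eq he
  rw [← h2 w hw, ← h2 w' hw'] at h4
  rw [h1 w hw, h1 w' hw']
  exact corner_eq_of_pt_eq (hinj h4)

theorem CellMapOn.degreeMapOn {F : L.Aff ≃ L'.Aff} (hF : CellMapOn L L' F Set.univ)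
    (hF' : CellMapOn L' L F.symm Set.univ) : DegreeMapOn L L' F Set.univ := by
  intro t i _
  obtain ⟨t', g, -, hg⟩ := hF.exists_tile t
  have h : F (L.pt t (cornerPt i)) = L'.pt t' (cornerPt (cornerMap g i)) := by
    rw [hg, symmAct_cornerPt]
  exact ⟨t', cornerMap g i, h, le_antisymm
    (hF'.degree_le F.symm.injective (by rw [← h, F.symm_apply_apply])) (hF.degree_le F.injective h)⟩

/-! ### Surjectivity of cell-preserving isometries -/

/-- A cell-preserving isometry of a locally finite complex into itself with a fixed point is
surjective, as it permutes the finitely many tiles meeting a ball about the fixed point. -/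
theorem CellMapOn.surjective_of_fixed {F : L.Aff → L.Aff} (hF : CellMapOn L L F Set.univ)
    (hF' : IsometryOn L L F Set.univ) (hL : L.PathConnected) (hL' : L.LocallyFinite) {x : L.Aff}
    (hx : F x = x) : Function.Surjective F := by
  choose τ g _ hg using hF.exists_tile
  intro y
  obtain ⟨t, p, rfl⟩ := exists_pt y
  set r := L.affDist x (L.pt t p)
  have hfin := finite_tiles_meeting_ball hL hL' x r
  have hmaps : Set.MapsTo τ {t | ∃ p, L.pt t p ∈ L.ball x r} {t | ∃ p, L.pt t p ∈ L.ball x r} := by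
    rintro s ⟨q, hq⟩
    refine ⟨symmAct (g s) q, ?_⟩
    rw [← hg]
    have := hF' x trivial (L.pt s q) trivial
    rw [hx] at this
    exact this.trans_le hq
  -- If s and s' have the same image tile, an interior point of s and some point of s' have the same
  -- image, so they coincide and s = s'.
  have hinj : Set.InjOn τ {t | ∃ p, L.pt t p ∈ L.ball x r} := by
    intro s _ s' _ h
    obtain ⟨z, hz⟩ := interior_pentagon_nonempty
    have h1 : F (L.pt s ⟨z, interior_subset hz⟩) =
        F (L.pt s' (symmAct (g s')⁻¹ (symmAct (g s) ⟨z, interior_subset hz⟩))) := by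
      rw [hg, hg, symmAct_symmAct_inv, h]
    exact (pt_injective_of_mem_interior hz (hF'.injective hL h1)).1
  have himage := hfin.eq_of_subset_of_encard_le' hmaps.image_subset hinj.encard_image.ge
  obtain ⟨s, -, hs⟩ := himage.ge (show t ∈ {t | ∃ p, L.pt t p ∈ L.ball x r} from ⟨p, le_refl r⟩)
  refine ⟨L.pt s (symmAct (g s)⁻¹ p), ?_⟩
  rw [hg, symmAct_symmAct_inv, hs]

/-- Some tile s contains the preimage of an interior point of t'. The tile onto which F maps s meets
the interior of t', hence is t'. -/
theorem CellMapOn.symm {F : L.Aff ≃ L'.Aff} (hF : CellMapOn L L' F Set.univ) :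
    CellMapOn L' L F.symm Set.univ := by
  rintro t' ⟨p, hp, -⟩
  obtain ⟨s, q, hsq⟩ := exists_pt (F.symm (L'.pt t' p))
  obtain ⟨t'', g, hd, hg⟩ := hF.exists_tile s
  rw [Equiv.symm_apply_eq, hg] at hsq
  obtain ⟨rfl, -⟩ := pt_injective_of_mem_interior hp hsq
  refine ⟨s, g⁻¹, by rw [hd, inv_smul_smul], fun r _ => ?_⟩
  rw [Equiv.symm_apply_eq, hg, symmAct_symmAct_inv]

/-! ### Pointed tilings -/

variable {κ : PentComplex.K.T → D} {a a' b b' c : PointedTiling κ}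

theorem PointedTiling.pathConnected (a : PointedTiling κ) : a.L.PathConnected := by
  obtain ⟨e⟩ := a.plane
  have : PreconnectedSpace a.L.Aff :=
    e.symm.surjective.denseRange.preconnectedSpace e.symm.continuous
  exact pathConnected_of_preconnected

theorem PointedTiling.locallyFinite (a : PointedTiling κ) : a.L.LocallyFinite := by
  obtain ⟨e⟩ := a.plane
  have : FirstCountableTopology a.L.Aff := e.isInducing.firstCountableTopology
  exact locallyFinite_of_firstCountable

theorem base_mem_ball {C : PentComplex} (x : C.Aff) {r : ℝ} (hr : 0 ≤ r) : x ∈ C.ball x r := by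
  rw [ball, Set.mem_ofPred_eq, affDist_self]
  exact hr

theorem admissible_id {ε : ℝ} (hε : 0 < ε) : Admissible a a ε id := by
  refine ⟨fun t _ => ⟨t, 1, by rw [one_smul], fun p _ => rfl⟩, fun t i _ => ⟨t, i, rfl, rfl⟩,
    fun y _ z _ => rfl, ?_⟩
  rw [id, affDist_self]
  exact hε.le

theorem Admissible.of_iso {ε : ℝ} {φ : a.L.Aff → b.L.Aff} (h : Admissible a b ε φ)
    (ha : a.Iso a') (hb : b.Iso b') : ∃ φ' : a'.L.Aff → b'.L.Aff, Admissible a' b' ε φ' := by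
  obtain ⟨F, hF, hF', hx⟩ := ha
  obtain ⟨G, hG, hG', hy⟩ := hb
  obtain ⟨h1, h2, h3, h4⟩ := h
  have hF'' : CellMapOn a.L a'.L F.symm.symm Set.univ := hF
  have hFx : F.symm a'.x = a.x := by rw [← hx, F.symm_apply_apply]
  have hi := hF'.isometryOn hF''
  have hm : Set.MapsTo F.symm (a'.L.ball a'.x (1 / ε)) (a.L.ball a.x (1 / ε)) := by
    intro y hy
    have := hi a'.x trivial y trivial
    rw [hFx] at this
    exact this.trans_le hy
  have hu := Set.subset_univ (a'.L.ball a'.x (1 / ε))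
  refine ⟨G ∘ φ ∘ F.symm, ?_, ?_, ?_, ?_⟩
  · exact ((hF'.mono hu).comp_mapsTo h1 hm).comp_mapsTo hG (Set.mapsTo_univ _ _)
  · exact (((hF'.degreeMapOn hF'').mono hu).comp_mapsTo h2 hm).comp_mapsTo (hG.degreeMapOn hG')
      (Set.mapsTo_univ _ _)
  · exact ((hi.mono hu).comp_mapsTo h3 hm).comp_mapsTo (hG.isometryOn hG') (Set.mapsTo_univ _ _)
  · rw [Function.comp, Function.comp, hFx, ← hy, hG.isometryOn hG' _ trivial _ trivial]
    exact h4

/-- The radii differ by 1/δ - 1/(ε + δ) = ε / (δ(ε + δ)). By `h` this is at least ε, which makes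
room for the displacement of the base point by φ. -/
theorem Admissible.comp {ε δ : ℝ} (hε : 0 < ε) (hδ : 0 < δ) (h : δ * (ε + δ) ≤ 1)
    {φ : a.L.Aff → b.L.Aff} {ψ : b.L.Aff → c.L.Aff} (hφ : Admissible a b ε φ)
    (hψ : Admissible b c δ ψ) : Admissible a c (ε + δ) (ψ ∘ φ) := by
  obtain ⟨h1, h2, h3, h4⟩ := hφ
  obtain ⟨k1, k2, k3, k4⟩ := hψ
  have hsub : a.L.ball a.x (1 / (ε + δ)) ⊆ a.L.ball a.x (1 / ε) := fun y hy =>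
    le_trans (show _ ≤ _ from hy) (one_div_le_one_div_of_le hε (by linarith))
  have hx : a.x ∈ a.L.ball a.x (1 / ε) := base_mem_ball _ (by positivity)
  have hr : ε + 1 / (ε + δ) ≤ 1 / δ := by
    rw [← sub_nonneg]
    have : 1 / δ - (ε + 1 / (ε + δ)) = ε * (1 - δ * (ε + δ)) / (δ * (ε + δ)) := by
      field_simp; ring
    rw [this]
    have : 0 ≤ 1 - δ * (ε + δ) := by linarith
    positivity
  rw [affDist_comm] at h4
  have hm : Set.MapsTo φ (a.L.ball a.x (1 / (ε + δ))) (b.L.ball b.x (1 / δ)) := by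
    intro y hy
    have t1 := b.pathConnected.affDist_triangle b.x (φ a.x) (φ y)
    rw [h3 _ hx y (hsub hy)] at t1
    have hy' : a.L.affDist a.x y ≤ _ := hy
    exact (by linarith : b.L.affDist b.x (φ y) ≤ 1 / δ)
  refine ⟨(h1.mono hsub).comp_mapsTo k1 hm, (h2.mono hsub).comp_mapsTo k2 hm,
    (h3.mono hsub).comp_mapsTo k3 hm, ?_⟩
  have t2 := c.pathConnected.affDist_triangle (ψ (φ a.x)) (ψ b.x) c.x
  rw [k3 _ (hm (base_mem_ball _ (by positivity))) _ (base_mem_ball _ (by positivity)),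
    affDist_comm (φ a.x) b.x] at t2
  exact t2.trans (add_le_add h4 k4)

/-! ### The distance -/

theorem Lam_comm (a b : PointedTiling κ) : Lam a b = Lam b a := by
  ext ε
  simp only [Lam, Set.mem_ofPred_eq, and_comm (a := ∃ φ : a.L.Aff → b.L.Aff, Admissible a b ε φ)]

theorem tilingDist_comm (a b : PointedTiling κ) : tilingDist a b = tilingDist b a := by
  rw [tilingDist, tilingDist, Lam_comm]

theorem Lam_subset_of_iso (ha : a.Iso a') (hb : b.Iso b') : Lam a b ⊆ Lam a' b' := by
  rintro ε ⟨hε, ⟨φ, hφ⟩, φ', hφ'⟩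
  exact ⟨hε, hφ.of_iso ha hb, hφ'.of_iso hb ha⟩

theorem tilingDist_congr (ha : a.Iso a') (hb : b.Iso b') : tilingDist a b = tilingDist a' b' := by
  have ha' : a'.Iso a := (PointedTiling.setoid κ).symm ha
  have hb' : b'.Iso b := (PointedTiling.setoid κ).symm hb
  rw [tilingDist, tilingDist,
    (Lam_subset_of_iso ha hb).antisymm (Lam_subset_of_iso ha' hb')]

theorem nonneg_of_mem_insert_Lam {ε : ℝ} (h : ε ∈ insert (1 / √2) (Lam a b)) : 0 ≤ ε := by
  rcases h with rfl | h
  · positivity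
  · exact h.1.le

theorem tilingDist_nonneg (a b : PointedTiling κ) : 0 ≤ tilingDist a b :=
  Real.sInf_nonneg fun _ => nonneg_of_mem_insert_Lam

theorem tilingDist_le {ε : ℝ} (h : ε ∈ insert (1 / √2) (Lam a b)) : tilingDist a b ≤ ε :=
  csInf_le ⟨0, fun _ => nonneg_of_mem_insert_Lam⟩ h

theorem exists_lt_of_tilingDist_lt {r : ℝ} (h : tilingDist a b < r) :
    ∃ ε ∈ insert (1 / √2) (Lam a b), ε < r :=
  exists_lt_of_csInf_lt (Set.insert_nonempty _ _) h

theorem tilingDist_le_add {ε δ : ℝ} (hε : ε ∈ insert (1 / √2) (Lam a b))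
    (hδ : δ ∈ insert (1 / √2) (Lam b c)) : tilingDist a c ≤ ε + δ := by
  have hε0 := nonneg_of_mem_insert_Lam hε
  have hδ0 := nonneg_of_mem_insert_Lam hδ
  rcases le_or_gt (1 / √2) (ε + δ) with h | h
  · exact (tilingDist_le (Set.mem_insert _ _)).trans h
  -- Below the cutoff neither summand can be the cutoff itself, so both come from admissible maps.
  -- Since ε + δ < 1/√2 ≤ 1, the condition of `Admissible.comp` holds in both directions.
  obtain ⟨hε', ⟨φ, hφ⟩, φ', hφ'⟩ := hε.resolve_left (by rintro rfl; linarith)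
  obtain ⟨hδ', ⟨ψ, hψ⟩, ψ', hψ'⟩ := hδ.resolve_left (by rintro rfl; linarith)
  have hsq : 1 / √2 ≤ 1 := by
    rw [div_le_one (by positivity)]
    exact Real.one_le_sqrt.2 one_le_two
  refine tilingDist_le (Or.inr ⟨by positivity, ⟨_, hφ.comp hε' hδ' (by nlinarith) hψ⟩, ?_⟩)
  rw [add_comm]
  exact ⟨_, hψ'.comp hδ' hε' (by nlinarith) hφ'⟩

theorem tilingDist_triangle (a b c : PointedTiling κ) :
    tilingDist a c ≤ tilingDist a b + tilingDist b c := by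
  refine le_of_forall_pos_le_add fun r hr => ?_
  obtain ⟨ε, hε, h⟩ := exists_lt_of_tilingDist_lt (lt_add_of_pos_right (tilingDist a b) (half_pos hr))
  obtain ⟨δ, hδ, h'⟩ := exists_lt_of_tilingDist_lt (lt_add_of_pos_right (tilingDist b c) (half_pos hr))
  linarith [tilingDist_le_add hε hδ]

theorem tilingDist_self (a : PointedTiling κ) : tilingDist a a = 0 :=
  le_antisymm (le_of_forall_pos_le_add fun ε hε => by
    rw [zero_add]
    exact tilingDist_le (Or.inr ⟨hε, ⟨id, admissible_id hε⟩, id, admissible_id hε⟩))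
    (tilingDist_nonneg a a)

/-- A tile lies in a ball about any given point. -/
theorem exists_affDist_pt_le {C : PentComplex} (hC : C.PathConnected) (x : C.Aff) (t : C.T) :
    ∃ r, ∀ p, C.affDist x (C.pt t p) ≤ r := by
  have hb : Bornology.IsBounded pentagon :=
    isBounded_convexHull.2 (Set.finite_range pentCorner).isBounded
  refine ⟨C.affDist x (C.pt t (cornerPt 0)) + Metric.diam pentagon, fun p => ?_⟩
  refine (hC.affDist_triangle _ (C.pt t (cornerPt 0)) _).trans (add_le_add le_rfl ?_)
  exact (PentComplex.Path.segment t _ _).affDist_le.trans (Metric.dist_le_diam_of_mem hb (cornerPt 0).2 p.2)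

/-- Admissible maps on larger and larger balls have a limit, as they map a given tile to one of
finitely many tiles. -/
theorem exists_limit_of_admissible
    (h : ∀ δ > 0, ∃ ε, 0 < ε ∧ ε < δ ∧ ∃ φ : a.L.Aff → b.L.Aff, Admissible a b ε φ) :
    ∃ F : a.L.Aff → b.L.Aff, CellMapOn a.L b.L F Set.univ ∧ IsometryOn a.L b.L F Set.univ ∧
      F a.x = b.x := by
  -- Convergence along a nonprincipal ultrafilter replaces the choice of a diagonal subsequence.
  have h' (n : ℕ) := h (1 / (n + 1)) (by positivity)
  choose ε hε0 hε φ hφ using h'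
  set U : Ultrafilter ℕ := Filter.hyperfilter ℕ with hU
  have hle : (U : Filter ℕ) ≤ Filter.atTop := Nat.hyperfilter_le_atTop
  have hsmall : ∀ δ > 0, ∀ᶠ n in (U : Filter ℕ), ε n < δ := by
    intro δ hδ
    have := tendsto_one_div_add_atTop_nhds_zero_nat (𝕜 := ℝ)
    filter_upwards [hle (this.eventually (gt_mem_nhds hδ))] with n hn using (hε n).trans hn
  have hlarge : ∀ r : ℝ, ∀ᶠ n in (U : Filter ℕ), r ≤ 1 / ε n := by
    intro r
    filter_upwards [hsmall (1 / (|r| + 1)) (by positivity)] with n hn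
    have := (lt_one_div (by positivity) (hε0 n)).2 hn
    linarith [le_abs_self r]
  have key (t : a.L.T) : ∃ (t' : b.L.T) (g : PentSymm), b.L.dec t' = g • a.L.dec t ∧
      ∀ᶠ n in (U : Filter ℕ), ∀ p, φ n (a.L.pt t p) = b.L.pt t' (symmAct g p) := by
    obtain ⟨r, hr⟩ := exists_affDist_pt_le a.pathConnected a.x t
    -- The image of t meets the ball of radius 1 + r: its points are within r of φ n a.x, which is
    -- within ε n < 1 of b.x. So finitely many pairs of tile and symmetry compete, and the
    -- ultrafilter selects one.
    have hfin := (finite_tiles_meeting_ball b.pathConnected b.locallyFinite b.x (1 + r)).prod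
      (Set.finite_univ (α := PentSymm))
    have hex : ∀ᶠ n in (U : Filter ℕ),
        ∃ σ ∈ {t | ∃ p, b.L.pt t p ∈ b.L.ball b.x (1 + r)} ×ˢ (Set.univ : Set PentSymm),
          b.L.dec σ.1 = σ.2 • a.L.dec t ∧
            ∀ p, φ n (a.L.pt t p) = b.L.pt σ.1 (symmAct σ.2 p) := by
      filter_upwards [hlarge r, hsmall 1 one_pos] with n hn hn1
      obtain ⟨h1, -, h3, h4⟩ := hφ n
      have hball (p : pentagon) : a.L.pt t p ∈ a.L.ball a.x (1 / ε n) := (hr p).trans hn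
      obtain ⟨z, hz⟩ := interior_pentagon_nonempty
      obtain ⟨t', g, hd, hg⟩ := h1 t ⟨⟨z, interior_subset hz⟩, hz, hball _⟩
      refine ⟨(t', g), ⟨⟨symmAct g (cornerPt 0), ?_⟩, trivial⟩, hd, fun p => hg p (hball p)⟩
      rw [← hg _ (hball _)]
      refine (b.pathConnected.affDist_triangle _ (φ n a.x) _).trans (add_le_add ?_ ?_)
      · rw [affDist_comm]
        exact h4.trans hn1.le
      · rw [h3 _ (base_mem_ball _ (one_div_pos.2 (hε0 n)).le) _ (hball _)]
        exact hr _
    obtain ⟨⟨t', g⟩, -, hσ⟩ := (Ultrafilter.eventually_exists_mem_iff hfin).1 hex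
    obtain ⟨n, hn⟩ := hσ.exists
    exact ⟨t', g, hn.1, hσ.mono fun n hn => hn.2⟩
  have hF (y : a.L.Aff) : ∃ z, ∀ᶠ n in (U : Filter ℕ), φ n y = z := by
    obtain ⟨t, p, rfl⟩ := exists_pt y
    obtain ⟨t', g, -, hg⟩ := key t
    exact ⟨_, hg.mono fun n hn => hn p⟩
  choose F hF using hF
  refine ⟨F, ?_, ?_, ?_⟩
  · intro t _
    obtain ⟨t', g, hd, hg⟩ := key t
    refine ⟨t', g, hd, fun p _ => ?_⟩
    obtain ⟨n, h1, h2⟩ := ((hF (a.L.pt t p)).and hg).exists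
    rw [← h1, h2]
  · intro y _ z _
    obtain ⟨n, h1, h2, h3, h4⟩ := ((hF y).and ((hF z).and ((hlarge (a.L.affDist a.x y)).and
      (hlarge (a.L.affDist a.x z))))).exists
    rw [← h1, ← h2]
    exact (hφ n).2.2.1 y h3 z h4
  · refine b.pathConnected.eq_of_affDist (le_antisymm ?_ (affDist_nonneg _ _))
    refine le_of_forall_pos_le_add fun δ hδ => ?_
    obtain ⟨n, h1, h2⟩ := ((hF a.x).and (hsmall δ hδ)).exists
    rw [← h1, zero_add]
    exact (hφ n).2.2.2.trans h2.le

theorem iso_of_tilingDist_eq_zero (h : tilingDist a b = 0) : a.Iso b := by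
  have hLam : ∀ δ > 0, ∃ ε ∈ Lam a b, ε < δ := by
    intro δ hδ
    have hpos : (0 : ℝ) < 1 / √2 := by positivity
    obtain ⟨ε, hε, hlt⟩ := exists_lt_of_tilingDist_lt (h.trans_lt (lt_min hδ hpos))
    refine ⟨ε, hε.resolve_left ?_, hlt.trans_le (min_le_left _ _)⟩
    exact (hlt.trans_le (min_le_right _ _)).ne
  obtain ⟨F, hF, hFi, hFx⟩ := exists_limit_of_admissible (a := a) (b := b) fun δ hδ => by
    obtain ⟨ε, ⟨h0, h1, -⟩, hlt⟩ := hLam δ hδ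
    exact ⟨ε, h0, hlt, h1⟩
  obtain ⟨G, hG, hGi, hGx⟩ := exists_limit_of_admissible (a := b) (b := a) fun δ hδ => by
    obtain ⟨ε, ⟨h0, -, h1⟩, hlt⟩ := hLam δ hδ
    exact ⟨ε, h0, hlt, h1⟩
  -- Isometry makes F injective; only surjectivity needs the second limit G.
  have hsurj : Function.Surjective (F ∘ G) :=
    (hG.comp hF).surjective_of_fixed (hGi.comp_mapsTo hFi (Set.mapsTo_univ _ _)) b.pathConnected
      b.locallyFinite (by rw [Function.comp, hGx, hFx])
  have hF' : CellMapOn a.L b.L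
      (Equiv.ofBijective F ⟨hFi.injective a.pathConnected, hsurj.of_comp⟩) Set.univ := hF
  exact ⟨_, hF', hF'.symm, hFx⟩

end PentHull

theorem mainTheorem5 {D : Type*} [MulAction PentHull.PentSymm D] (κ : PentHull.PentComplex.K.T → D) :
    ∃ d : PentHull.Hull κ → PentHull.Hull κ → ℝ,
      (∀ a b : PentHull.PointedTiling κ,
        d (PentHull.Hull.mk a) (PentHull.Hull.mk b) = PentHull.tilingDist a b) ∧
      (∀ X Y, 0 ≤ d X Y) ∧
      (∀ X Y, d X Y = 0 ↔ X = Y) ∧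
      (∀ X Y, d X Y = d Y X) ∧
      (∀ X Y Z, d X Z ≤ d X Y + d Y Z) := by
  refine ⟨Quotient.lift₂ PentHull.tilingDist fun _ _ _ _ h h' => PentHull.tilingDist_congr h h',
    fun a b => rfl, ?_, ?_, ?_, ?_⟩
  · rintro ⟨a⟩ ⟨b⟩
    exact PentHull.tilingDist_nonneg a b
  · rintro ⟨a⟩ ⟨b⟩
    refine ⟨fun h => Quotient.sound (PentHull.iso_of_tilingDist_eq_zero h), fun h => ?_⟩
    rw [h]
    exact PentHull.tilingDist_self b
  · rintro ⟨a⟩ ⟨b⟩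
    exact PentHull.tilingDist_comm a b
  · rintro ⟨a⟩ ⟨b⟩ ⟨c⟩
    exact PentHull.tilingDist_triangle a b c
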